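/- For a positive integer $Q$ let $\mathcal F_Q=\{a/q : 1\le q\le Q,\ 0<a\le q,\ \gcd(a,q)=1\}=\{\gamma_1<\gamma_2<\dots<\gamma_{N(Q)}=1\}$ be the Farey fractions of order $Q$, extended to all indices $i\in\mathbb Z$ by $\gamma_{i+N(Q)}=\gamma_i+1$. Write $\gamma_i=p_i/q_i$ in lowest terms with $q_i>0$, and for an integer $k\ge 0$ put $\nu_k(\gamma_i)=p_{i+k-1}q_{i-1}-p_{i-1}q_{i+k-1}$. Let $\mathcal T=\{(x,y)\in[0,1]^2 : x+y>1\}$ be the Farey triangle and let $T:\mathcal T\to\mathcal T$ be the map $T(x,y)=\left(y,\left\lfloor\frac{1+x}{y}\right\rfloor y-x\right)$. For $\ell\ge1$ let $\mathcal T_\ell=\{(x,y)\in\mathcal T:\lfloor (1+x)/y\rfloor=\ell\}$ and $\mathcal T_\ell^*=\bigcup_{r\ge \ell}\mathcal T_r$. Let $K_0=1$, $K_1(x_1)=x_1$ and $K_n(x_1,\dots,x_n)=x_nK_{n-1}(x_1,\dots,x_{n-1})+K_{n-2}(x_1,\dots,x_{n-2})$ for $n\ge2$. Each $K_n$ is a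 sum of distinct square-free monomials $\prod_{j\in J}x_j$, $J\subseteq\{1,\dots,n\}$; let $\mathcal J_n$ be the family of the sets $J$ that occur. For $k\ge1$ and $J\in\mathcal J_{k-1}$ put $\varepsilon_k(J)=\left(\frac{2k-1}{2}\right)\prod_{j\in J}(-1)^j\in\{1,-1\}$, where $\left(\frac{n}{2}\right)$ is the Kronecker symbol, equal to $0$ for even $n$, to $1$ for $n\equiv\pm1\pmod 8$ and to $-1$ for $n\equiv\pm3\pmod 8$. **Theorem.** For each integer $k\ge0$ there is a real constant $B(k)$ such that $$\frac1{N(Q)}\sum_{i=1}^{N(Q)}\nu_k(\gamma_i)=B(k)+O_k\!\left(\frac{(\log Q)^2}{Q}\right)\qquad(Q\to\infty).$$ Moreover $B(0)=0$, and for each $k\ge1$ $$B(k)=2\sum_{J\in\mathcal J_{k-1}}\varepsilon_k(J)\sum_{(\ell_j)_{j\in J}\in\mathbb Z_{\ge1}^{J}}\operatorname{area}\Big(\bigcap_{j\in J}T^{1-j}\mathcal T_{\ell_j}^*\Big),$$ where every inner series converges, $T^{1-j}$ denotes the preimage under $T^{j-1}$ in $\mathcal T$, and for $J=\emptyset$ the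 inner sum is the single term $\operatorname{area}(\mathcal T)$. -/

import Mathlib

open Filter Asymptotics MeasureTheory

noncomputable section

namespace FareyIndex

/-- The Farey fractions of order `Q`: all `a / q` with `1 ≤ q ≤ Q`, `0 < a ≤ q`, `(a, q) = 1`. -/
def farey (Q : ℕ) : Finset ℚ :=
  (((Finset.Icc 1 Q) ×ˢ (Finset.Icc 1 Q)).filter
    (fun x : ℕ × ℕ => x.1 ≤ x.2 ∧ Nat.Coprime x.1 x.2)).image
      (fun x : ℕ × ℕ => (x.1 : ℚ) / (x.2 : ℚ))

/-- `N(Q)`, the number of Farey fractions of order `Q`. -/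
def N (Q : ℕ) : ℕ := (farey Q).card

/-- The increasing enumeration `γ_1 < γ_2 < ⋯ < γ_{N(Q)}` of the Farey fractions of order `Q`,
extended to all `i ∈ ℤ` by `γ_{i + N(Q)} = γ_i + 1`. (The list `sort` is indexed from `0`; for
`Q ≥ 1` the index `(i - 1) % N(Q)` is always within range.) -/
def gam (Q : ℕ) (i : ℤ) : ℚ :=
  ((farey Q).sort (· ≤ ·)).getD ((i - 1) % (N Q : ℤ)).toNat 0 + (((i - 1) / (N Q : ℤ) : ℤ) : ℚ)

/-- The numerator `p_i` of `γ_i` in lowest terms. -/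
def p (Q : ℕ) (i : ℤ) : ℤ := (gam Q i).num

/-- The denominator `q_i` of `γ_i` in lowest terms. -/
def q (Q : ℕ) (i : ℤ) : ℤ := ((gam Q i).den : ℤ)

/-- The `k`-index `ν_k(γ_i) = p_{i+k-1} q_{i-1} - p_{i-1} q_{i+k-1}`. -/
def nu (Q k : ℕ) (i : ℤ) : ℤ :=
  p Q (i + k - 1) * q Q (i - 1) - p Q (i - 1) * q Q (i + k - 1)

/-- The average of `ν_k` over the Farey fractions of order `Q`. -/
def average (Q k : ℕ) : ℝ :=
  (1 / (N Q : ℝ)) * ∑ i ∈ Finset.Icc (1 : ℤ) (N Q : ℤ), (nu Q k i : ℝ)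

/-- The convergent polynomials `K_n(x_1, …, x_n)`; the variable `x_j` is `X j`. -/
def K : ℕ → MvPolynomial ℕ ℤ
  | 0 => 1
  | 1 => MvPolynomial.X 1
  | n + 2 => MvPolynomial.X (n + 2) * K (n + 1) + K n

/-- The Farey triangle. -/
def triangle : Set (ℝ × ℝ) :=
  {z | z.1 ∈ Set.Icc (0 : ℝ) 1 ∧ z.2 ∈ Set.Icc (0 : ℝ) 1 ∧ 1 < z.1 + z.2}

/-- The map `T(x, y) = (y, [(1 + x) / y] y - x)`; it is only used on the Farey triangle, which it
maps to itself. -/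
def T (z : ℝ × ℝ) : ℝ × ℝ := (z.2, (⌊(1 + z.1) / z.2⌋ : ℝ) * z.2 - z.1)

/-- The region `𝒯_k` of the Farey triangle. -/
def region (k : ℕ) : Set (ℝ × ℝ) := {z | z ∈ triangle ∧ ⌊(1 + z.1) / z.2⌋ = (k : ℤ)}

/-- The region `𝒯_k^* = ⋃_{ℓ ≥ k} 𝒯_ℓ`. -/
def regionStar (k : ℕ) : Set (ℝ × ℝ) := ⋃ l ≥ k, region l

/-- For a finite set `J = {j_1, …, j_n}` of positive integers and positive integers `ℓ_j` (`j ∈ J`),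
the area of `T^{1 - j_1} 𝒯_{ℓ_{j_1}}^* ∩ ⋯ ∩ T^{1 - j_n} 𝒯_{ℓ_{j_n}}^*`. Here `T` is regarded as a
self-map of the Farey triangle, so preimages are taken inside the triangle, and the
intersection over `J = ∅` is the whole triangle. -/
def interArea (J : Finset ℕ) (l : J → ℕ+) : ℝ :=
  volume.real (triangle ∩ ⋂ j : J, (T^[(j : ℕ) - 1]) ⁻¹' regionStar (l j))

/-- The sign of the monomial `∏_{j ∈ J} x_j` of `K_{k-1}(x_1, …, x_{k-1})` in
`((2k - 1) / 2) K_{k-1}(-x_1, x_2, …, (-1)^{k-1} x_{k-1})`, where `(n / 2)` is the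
Kronecker symbol, i.e. the even Dirichlet character `χ₈` modulo `8`. -/
def sign (k : ℕ) (J : Finset ℕ) : ℤ :=
  ZMod.χ₈ ((2 * (k : ℤ) - 1 : ℤ) : ZMod 8) * ∏ j ∈ J, (-1 : ℤ) ^ j

end FareyIndex

end

/-!
The numerators and denominators of consecutive Farey fractions satisfy the same three-term
recurrence, with coefficient `a_i = ⌊(Q + q_{i-1}) / q_i⌋`, so `ν_k(γ_i)` is a continuant of
`a_i, …, a_{i+k-2}` with minus signs. Up to the Kronecker symbol it is `K_{k-1}` evaluated at
`(-1)^j a_{i+j-1}` (`nu_eq_sum`). Moreover `a_{i+j-1}` is the index `⌊(1 + x) / y⌋` at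
`T^{j-1}(q_{i-1} / Q, q_i / Q)`, and these points run exactly once through the scaled coprime pairs
of the Farey triangle (`sum_point`). It remains to show that, for a finite set `J` of times, the
product `idxProd J` of the indices along an orbit is equidistributed over these points with error
`O(Q (log Q)²)` (`equidistributes_idxProd`), and that its integral is the sum of the areas in the
theorem; the latter is Tonelli's theorem (`hasSum_interArea`).

Equidistribution rests on three facts.

* For a Boolean combination of half-planes, the lattice points of the `R`-fold dilate are counted by
  its area up to the number of unit cells met by a boundary line, which is `O(R)`. Möbius inversion
  turns this into a count of coprime points with error `O(Q log Q)`
  (`equidistributes_indicator`).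
* The set where the index is at least `l` lies in a square of side `2 / l`, which gives the error
  `O((Q / l) log Q)`. Summing over `l ≤ 2Q` shows that the unbounded index itself is equidistributed
  with error `O(Q (log Q)²)` (`equidistributes_idx`).
* If the index is large at one time then it equals `1` at the two neighbouring times and `2` at the
  other nearby times (`idx_near_large`). So, for suitable constants `c_j`, the difference between
  `idxProd J` and `∑_{j ∈ J} c_j ⌊(1 + x) / y⌋ ∘ T^{j-1}` takes finitely many values, each on a
  polygonal set. The individual terms are handled by invariance: `T` preserves area on the triangle
  (`measurePreserving_T`) and permutes the Farey points (`cnt_comp_T`).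
-/

noncomputable section

namespace FareyIndex

/-! ### The dynamics of `T` on the Farey triangle -/

/-- The index function `⌊(1 + x) / y⌋` on the Farey triangle, as a natural number. -/
def idx (z : ℝ × ℝ) : ℕ := ⌊(1 + z.1) / z.2⌋₊

/-- The fibrewise reflection `(x, y) ↦ (⌊(1 + x) / y⌋ y - x, y)`. On the Farey triangle it is an
involution, and `T` is its composition with the coordinate swap. -/
def reflect (z : ℝ × ℝ) : ℝ × ℝ := ((idx z : ℝ) * z.2 - z.1, z.2)

lemma mem_triangle {z : ℝ × ℝ} :
    z ∈ triangle ↔ (0 < z.1 ∧ z.1 ≤ 1) ∧ (0 < z.2 ∧ z.2 ≤ 1) ∧ 1 < z.1 + z.2 := by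
  simp only [triangle, Set.mem_ofPred_eq, Set.mem_Icc]
  constructor
  · rintro ⟨⟨h1, h2⟩, ⟨h3, h4⟩, h5⟩
    exact ⟨⟨by linarith, h2⟩, ⟨by linarith, h4⟩, h5⟩
  · rintro ⟨⟨h1, h2⟩, ⟨h3, h4⟩, h5⟩
    exact ⟨⟨h1.le, h2⟩, ⟨h3.le, h4⟩, h5⟩

lemma natCast_idx {z : ℝ × ℝ} (hz : z ∈ triangle) : ((idx z : ℕ) : ℤ) = ⌊(1 + z.1) / z.2⌋ := by
  obtain ⟨⟨h1, -⟩, ⟨h3, -⟩, -⟩ := mem_triangle.1 hz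
  exact Int.natCast_floor_eq_floor (by positivity)

lemma T_eq {z : ℝ × ℝ} (hz : z ∈ triangle) : T z = (reflect z).swap := by
  simp only [T, reflect, Prod.swap, ← natCast_idx hz, Int.cast_natCast]

lemma le_idx_iff {z : ℝ × ℝ} (hz : z ∈ triangle) (l : ℕ) :
    l ≤ idx z ↔ (l : ℝ) * z.2 ≤ 1 + z.1 := by
  obtain ⟨⟨h1, -⟩, ⟨h3, -⟩, -⟩ := mem_triangle.1 hz
  rw [idx, Nat.le_floor_iff (by positivity), le_div_iff₀ h3]

lemma idx_eq_iff {z : ℝ × ℝ} (hz : z ∈ triangle) (l : ℕ) :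
    idx z = l ↔ (l : ℝ) * z.2 ≤ 1 + z.1 ∧ 1 + z.1 < ((l : ℝ) + 1) * z.2 := by
  have h1 := le_idx_iff hz l
  have h2 := le_idx_iff hz (l + 1)
  push_cast at h2
  rw [← h1, ← not_le, ← h2]
  omega

lemma one_le_idx {z : ℝ × ℝ} (hz : z ∈ triangle) : 1 ≤ idx z := by
  rw [le_idx_iff hz]
  obtain ⟨⟨h1, -⟩, ⟨-, h3⟩, -⟩ := mem_triangle.1 hz
  push_cast
  linarith

lemma region_eq (l : ℕ) : region l = {z | z ∈ triangle ∧ idx z = l} := by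
  ext z
  simp only [region, Set.mem_ofPred_eq]
  refine and_congr_right fun hz => ?_
  rw [← natCast_idx hz]
  exact Nat.cast_inj

lemma mem_regionStar {l : ℕ} {z : ℝ × ℝ} : z ∈ regionStar l ↔ z ∈ triangle ∧ l ≤ idx z := by
  simp [regionStar, region_eq, and_comm]

lemma swap_mem_triangle {z : ℝ × ℝ} : z.swap ∈ triangle ↔ z ∈ triangle := by
  rw [mem_triangle, mem_triangle, Prod.fst_swap, Prod.snd_swap, add_comm]
  tauto

lemma reflect_mem {z : ℝ × ℝ} (hz : z ∈ triangle) : reflect z ∈ triangle := by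
  obtain ⟨h1, h2⟩ := (idx_eq_iff hz _).1 rfl
  obtain ⟨⟨h3, h4⟩, ⟨h5, h6⟩, h7⟩ := mem_triangle.1 hz
  rw [mem_triangle]
  simp only [reflect]
  refine ⟨⟨by linarith, by linarith⟩, ⟨h5, h6⟩, by linarith⟩

lemma idx_reflect {z : ℝ × ℝ} (hz : z ∈ triangle) : idx (reflect z) = idx z := by
  rw [idx_eq_iff (reflect_mem hz)]
  obtain ⟨⟨h3, h4⟩, ⟨h5, h6⟩, h7⟩ := mem_triangle.1 hz
  simp only [reflect]
  constructor <;> linarith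

lemma reflect_reflect {z : ℝ × ℝ} (hz : z ∈ triangle) : reflect (reflect z) = z := by
  have h := idx_reflect hz
  rw [reflect, h]
  simp [reflect]

lemma T_mem {z : ℝ × ℝ} (hz : z ∈ triangle) : T z ∈ triangle := by
  rw [T_eq hz]
  exact swap_mem_triangle.2 (reflect_mem hz)

lemma iterate_T_mem {z : ℝ × ℝ} (hz : z ∈ triangle) (n : ℕ) : T^[n] z ∈ triangle := by
  induction n with
  | zero => exact hz
  | succ n ih => rw [Function.iterate_succ_apply']; exact T_mem ih

/-- Reversing an orbit of `T` gives an orbit of `T`. -/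
lemma T_swap_T {z : ℝ × ℝ} (hz : z ∈ triangle) : T (T z).swap = z.swap := by
  rw [T_eq hz, Prod.swap_swap, T_eq (reflect_mem hz), reflect_reflect hz]

lemma idx_swap_T {z : ℝ × ℝ} (hz : z ∈ triangle) : idx (T z).swap = idx z := by
  rw [T_eq hz, Prod.swap_swap, idx_reflect hz]

lemma iterate_T_swap {z : ℝ × ℝ} (hz : z ∈ triangle) (n m : ℕ) :
    T^[m] (T^[n + m] z).swap = (T^[n] z).swap := by
  induction m with
  | zero => rfl
  | succ m ih =>
    rw [Function.iterate_succ_apply, ← add_assoc, Function.iterate_succ_apply' T (n + m),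
      T_swap_T (iterate_T_mem hz _), ih]

/-- The value of the index `m` steps away from a large index: `1` for the two neighbours
and `2` further on. -/
def tailIdx (m : ℕ) : ℕ := if m = 1 then 1 else 2

/-- If `z = (x, y)` has a large index, then `y` is small and the orbit of `z` continues with
`y, x', x' - y, x' - 2y, …`, where `x' > 1 - y`. -/
lemma iterate_T_of_large {z : ℝ × ℝ} (hz : z ∈ triangle) (n : ℕ) (hn : 4 * n + 6 < idx z) :
    ∀ m, 1 ≤ m → m ≤ n + 1 → T^[m + 1] z =
      ((reflect z).1 - (m - 1 : ℝ) * z.2, (reflect z).1 - (m : ℝ) * z.2) ∧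
      idx (T^[m] z) = tailIdx m := by
  obtain ⟨⟨h1, h2⟩, ⟨h3, h4⟩, h5⟩ := mem_triangle.1 (reflect_mem hz)
  have hy : (reflect z).2 = z.2 := rfl
  rw [hy] at h3 h4 h5
  -- an index of at least `4n + 7` bounds `y` by `2 / (4n + 7)`, which is small
  -- enough for the indices `2` to persist up to time `n + 1`
  have hsmall : (2 * (n : ℝ) + 3.5) * z.2 ≤ 1 := by
    have := (le_idx_iff hz (4 * n + 7)).1 hn
    obtain ⟨⟨-, h2⟩, -, -⟩ := mem_triangle.1 hz
    push_cast at this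
    linarith
  intro m hm
  induction m, hm using Nat.le_induction with
  | base =>
    intro _
    have hT : T z = (z.2, (reflect z).1) := by rw [T_eq hz]; rfl
    have hidx : idx (T z) = 1 := by
      rw [idx_eq_iff (T_mem hz), hT]
      push_cast
      have : 0 ≤ (n : ℝ) * z.2 := by positivity
      constructor <;> nlinarith
    refine ⟨?_, by simpa [tailIdx] using hidx⟩
    rw [Function.iterate_succ_apply', Function.iterate_one, T_eq (T_mem hz), reflect, hidx, hT]
    simp
  | succ m hm ih =>
    intro hmn
    obtain ⟨ih, -⟩ := ih (by omega)
    have hmem := iterate_T_mem hz (m + 1)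
    have hmn' : (m : ℝ) * z.2 ≤ n * z.2 := by
      gcongr
      omega
    have hm0 : 0 ≤ (m : ℝ) * z.2 := by positivity
    have hidx : idx (T^[m + 1] z) = 2 := by
      rw [idx_eq_iff hmem, ih]
      push_cast
      constructor <;> nlinarith
    refine ⟨?_, by rw [hidx, tailIdx, if_neg (by omega)]⟩
    rw [Function.iterate_succ_apply', T_eq hmem, reflect, hidx, ih]
    push_cast
    simp only [Prod.swap_prod_mk, Prod.mk.injEq]
    constructor <;> ring

lemma idx_after_large {z : ℝ × ℝ} (hz : z ∈ triangle) {n i j : ℕ} (hij : i < j) (hj : j ≤ n)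
    (hn : 4 * n + 6 < idx (T^[i] z)) : idx (T^[j] z) = tailIdx (j - i) := by
  have h := (iterate_T_of_large (iterate_T_mem hz i) n hn (j - i) (by omega) (by omega)).2
  rwa [← Function.iterate_add_apply, Nat.sub_add_cancel hij.le] at h

lemma idx_before_large {z : ℝ × ℝ} (hz : z ∈ triangle) {n i j : ℕ} (hij : i < j) (hj : j ≤ n)
    (hn : 4 * n + 6 < idx (T^[j] z)) : idx (T^[i] z) = tailIdx (j - i) := by
  -- the orbit is run backwards from `T^[j + 1] z`
  have hmem := iterate_T_mem hz (j + 1)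
  have h0 : idx (T^[j + 1] z).swap = idx (T^[j] z) := by
    rw [Function.iterate_succ_apply', idx_swap_T (iterate_T_mem hz j)]
  have h := (iterate_T_of_large (swap_mem_triangle.2 hmem) n (by rw [h0]; exact hn)
    (j - i) (by omega) (by omega)).2
  have he : j + 1 = (i + 1) + (j - i) := by omega
  rw [he, iterate_T_swap hz, Function.iterate_succ_apply', idx_swap_T (iterate_T_mem hz i)] at h
  exact h

/-! ### Polygonal sets and lattice points -/

/-- `Polygonal k S`: the plane set `S` is a Boolean combination of `k` half-planes (with
repetitions counted). -/
inductive Polygonal : ℕ → Set (ℝ × ℝ) → Prop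
  | half (a b c : ℝ) : Polygonal 1 {z | a * z.1 + b * z.2 ≤ c}
  | compl {k : ℕ} {S : Set (ℝ × ℝ)} : Polygonal k S → Polygonal k Sᶜ
  | inter {k l : ℕ} {S S' : Set (ℝ × ℝ)} :
      Polygonal k S → Polygonal l S' → Polygonal (k + l) (S ∩ S')

lemma Polygonal.measurableSet {k : ℕ} {S : Set (ℝ × ℝ)} (h : Polygonal k S) :
    MeasurableSet S := by
  induction h with
  | half a b c => exact measurableSet_le (by fun_prop) (by fun_prop)
  | compl _ ih => exact ih.compl
  | inter _ _ ih ih' => exact ih.inter ih'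

lemma Polygonal.union {k l : ℕ} {S S' : Set (ℝ × ℝ)} (h : Polygonal k S) (h' : Polygonal l S') :
    Polygonal (k + l) (S ∪ S') := by
  have := (h.compl.inter h'.compl).compl
  rwa [Set.compl_inter, compl_compl, compl_compl] at this

lemma polygonal_univ : Polygonal 1 (Set.univ : Set (ℝ × ℝ)) := by
  have := Polygonal.half 0 0 0
  simpa using this

lemma polygonal_empty : Polygonal 1 (∅ : Set (ℝ × ℝ)) := by
  simpa using polygonal_univ.compl

lemma polygonal_biUnion {ι : Type*} (s : Finset ι) (f : ι → Set (ℝ × ℝ))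
    (h : ∀ i ∈ s, ∃ k, Polygonal k (f i)) : ∃ k, Polygonal k (⋃ i ∈ s, f i) := by
  classical
  induction s using Finset.induction_on with
  | empty => exact ⟨1, by simpa using polygonal_empty⟩
  | insert a s ha ih =>
    obtain ⟨k, hk⟩ := h a (Finset.mem_insert_self _ _)
    obtain ⟨l, hl⟩ := ih fun i hi => h i (Finset.mem_insert_of_mem hi)
    exact ⟨k + l, by rw [Finset.set_biUnion_insert]; exact hk.union hl⟩

lemma polygonal_lt (a b c : ℝ) : Polygonal 1 {z : ℝ × ℝ | c < a * z.1 + b * z.2} := by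
  have := (Polygonal.half a b c).compl
  simpa [Set.compl_def] using this

/-- The linear branch of `T` on the region where the index equals `l`. -/
def branch (l : ℕ) (z : ℝ × ℝ) : ℝ × ℝ := (z.2, (l : ℝ) * z.2 - z.1)

lemma T_eq_branch {z : ℝ × ℝ} (hz : z ∈ triangle) : T z = branch (idx z) z := T_eq hz

lemma Polygonal.preimage_branch {k : ℕ} {S : Set (ℝ × ℝ)} (h : Polygonal k S) (l : ℕ) :
    Polygonal k (branch l ⁻¹' S) := by
  induction h with
  | half a b c =>
    convert Polygonal.half (-b) (a + b * l) c using 2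
    ext z
    simp only [branch, Set.preimage, Set.mem_ofPred_eq]
    ring_nf
  | compl _ ih => exact ih.compl
  | inter _ _ ih ih' => exact ih.inter ih'

lemma polygonal_triangle : Polygonal 5 triangle := by
  have h := ((Polygonal.half (-1) 0 0).inter (Polygonal.half 1 0 1)).inter
    (((Polygonal.half 0 (-1) 0).inter (Polygonal.half 0 1 1)).inter (polygonal_lt 1 1 1))
  convert h using 1
  ext z
  simp [triangle, Set.mem_Icc, and_assoc]

lemma measurableSet_triangle : MeasurableSet triangle := polygonal_triangle.measurableSet

lemma polygonal_regionStar (l : ℕ) : Polygonal 6 (regionStar l) := by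
  convert polygonal_triangle.inter (Polygonal.half (-1) l 1) using 1
  ext z
  rw [mem_regionStar, Set.mem_inter_iff, Set.mem_ofPred_eq]
  refine and_congr_right fun hz => ?_
  rw [le_idx_iff hz]
  constructor <;> intro h <;> linarith

lemma polygonal_region (l : ℕ) : Polygonal 12 (region l) := by
  convert (polygonal_regionStar l).inter (polygonal_regionStar (l + 1)).compl using 1
  ext z
  rw [region_eq, Set.mem_inter_iff, Set.mem_compl_iff, mem_regionStar, mem_regionStar,
    Set.mem_ofPred_eq]
  constructor
  · rintro ⟨h, rfl⟩
    exact ⟨⟨h, le_rfl⟩, fun h' => by omega⟩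
  · rintro ⟨⟨h, h1⟩, h2⟩
    exact ⟨h, by by_contra hne; exact h2 ⟨h, by omega⟩⟩

/-- The half-open square of side `1 / R` with upper right corner `(m / R, n / R)`. -/
def cell (R : ℝ) (x : ℤ × ℤ) : Set (ℝ × ℝ) :=
  Set.Ioc (((x.1 : ℝ) - 1) / R) (x.1 / R) ×ˢ Set.Ioc (((x.2 : ℝ) - 1) / R) (x.2 / R)

/-- The lattice point `x` scaled by `1 / R`. -/
def scaled (R : ℝ) (x : ℤ × ℤ) : ℝ × ℝ := ((x.1 : ℝ) / R, (x.2 : ℝ) / R)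

/-- The cell of `x` meets both `S` and its complement. -/
def Mixed (S : Set (ℝ × ℝ)) (R : ℝ) (x : ℤ × ℤ) : Prop :=
  (∃ z ∈ cell R x, z ∈ S) ∧ ∃ z ∈ cell R x, z ∉ S

lemma mem_cell {R : ℝ} (hR : 0 < R) {x : ℤ × ℤ} {z : ℝ × ℝ} :
    z ∈ cell R x ↔ x.1 = ⌈R * z.1⌉ ∧ x.2 = ⌈R * z.2⌉ := by
  simp only [cell, Set.mem_prod, Set.mem_Ioc, div_lt_iff₀ hR, le_div_iff₀ hR]
  rw [eq_comm, Int.ceil_eq_iff, eq_comm, Int.ceil_eq_iff, mul_comm R, mul_comm R]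

lemma scaled_mem_cell {R : ℝ} (hR : 0 < R) (x : ℤ × ℤ) : scaled R x ∈ cell R x := by
  rw [mem_cell hR]
  simp [scaled, mul_div_cancel₀ _ hR.ne']

lemma measurableSet_cell (R : ℝ) (x : ℤ × ℤ) : MeasurableSet (cell R x) :=
  measurableSet_Ioc.prod measurableSet_Ioc

lemma volume_cell {R : ℝ} (hR : 0 < R) (x : ℤ × ℤ) :
    volume (cell R x) = ENNReal.ofReal (1 / R ^ 2) := by
  rw [cell, Measure.volume_eq_prod, Measure.prod_prod, Real.volume_Ioc, Real.volume_Ioc,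
    ← ENNReal.ofReal_mul (by rw [← sub_div]; exact div_nonneg (by linarith) hR.le)]
  congr 1
  field_simp
  ring

lemma card_int_near (t : ℝ) (s : Finset ℤ) (hs : ∀ n ∈ s, |(n : ℝ) - t| ≤ 2) : s.card ≤ 5 := by
  have hsub : s ⊆ Finset.Icc ⌈t - 2⌉ ⌊t + 2⌋ := by
    intro n hn
    have := abs_le.1 (hs n hn)
    rw [Finset.mem_Icc, Int.ceil_le, Int.le_floor]
    constructor <;> linarith
  refine (Finset.card_le_card hsub).trans ?_
  rw [Int.card_Icc]
  have h1 := Int.le_ceil (t - 2)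
  have h2 := Int.floor_le (t + 2)
  have : ((⌊t + 2⌋ - ⌈t - 2⌉ : ℤ) : ℝ) ≤ 4 := by push_cast; linarith
  have : ⌊t + 2⌋ - ⌈t - 2⌉ ≤ 4 := by exact_mod_cast this
  omega

open Classical in
lemma card_near_line_aux {a b : ℝ} (hb : b ≠ 0) (hab : |a| ≤ |b|) (c : ℝ) (I J : Finset ℤ) :
    ((I ×ˢ J).filter fun x : ℤ × ℤ => |a * x.1 + b * x.2 - c| ≤ |a| + |b|).card ≤ 5 * I.card := by
  have hb' : 0 < |b| := abs_pos.2 hb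
  rw [Finset.card_filter, Finset.sum_product, mul_comm, ← smul_eq_mul, ← Finset.sum_const]
  refine Finset.sum_le_sum fun m _ => ?_
  rw [← Finset.card_filter]
  refine card_int_near ((c - a * m) / b) _ fun n hn => ?_
  have h := (Finset.mem_filter.1 hn).2
  have he : a * (m : ℝ) + b * n - c = b * (n - (c - a * m) / b) := by field_simp; ring
  simp only at h
  rw [he, abs_mul] at h
  nlinarith

open Classical in
/-- The number of lattice points of a box near a line is bounded by the side lengths of the box,
uniformly in the line. -/
lemma card_near_line {a b : ℝ} (hab : a ≠ 0 ∨ b ≠ 0) (c : ℝ) (I J : Finset ℤ) :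
    ((I ×ˢ J).filter fun x : ℤ × ℤ => |a * x.1 + b * x.2 - c| ≤ |a| + |b|).card ≤
      5 * (I.card + J.card) := by
  rcases le_total |a| |b| with h | h
  · have hb : b ≠ 0 := by
      rintro rfl
      have : a = 0 := by simpa using h
      simp [this] at hab
    exact (card_near_line_aux hb h c I J).trans (by omega)
  · have ha : a ≠ 0 := by
      rintro rfl
      have : b = 0 := by simpa using h
      simp [this] at hab
    refine le_trans (le_trans (le_of_eq ?_) (card_near_line_aux ha h c J I)) (by omega)
    refine Finset.card_bij' (fun x _ => x.swap) (fun x _ => x.swap) ?_ ?_ ?_ ?_ <;>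
      simp +contextual [add_comm]

open Classical in
lemma Polygonal.card_mixed_le {k : ℕ} {S : Set (ℝ × ℝ)} (h : Polygonal k S) {R : ℝ} (hR : 0 < R)
    (I J : Finset ℤ) : ((I ×ˢ J).filter (Mixed S R)).card ≤ 5 * k * (I.card + J.card) := by
  induction h with
  | half a b c =>
    by_cases hab : a ≠ 0 ∨ b ≠ 0
    · rw [mul_one]
      refine (Finset.card_le_card ?_).trans (card_near_line hab (c * R) I J)
      refine Finset.monotone_filter_right _ fun x _ hx => ?_
      obtain ⟨⟨z, hz, hzS⟩, w, hw, hwS⟩ := hx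
      -- a point of the cell differs from its corner, after scaling, by less than `1`
      have key : ∀ z ∈ cell R x, |a * x.1 + b * x.2 - (a * z.1 + b * z.2) * R| ≤ |a| + |b| := by
        intro z hz
        simp only [cell, Set.mem_prod, Set.mem_Ioc, div_lt_iff₀ hR, le_div_iff₀ hR] at hz
        have e : a * x.1 + b * x.2 - (a * z.1 + b * z.2) * R
          = a * (x.1 - z.1 * R) + b * (x.2 - z.2 * R) := by ring
        rw [e]
        refine (abs_add_le _ _).trans (add_le_add ?_ ?_) <;> rw [abs_mul] <;>
          refine mul_le_of_le_one_right (abs_nonneg _) (abs_le.2 ⟨?_, ?_⟩) <;> linarith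
      have h1 := abs_le.1 (key z hz)
      have h2 := abs_le.1 (key w hw)
      simp only [Set.mem_ofPred_eq, not_le] at hzS hwS
      have h3 := mul_le_mul_of_nonneg_right hzS hR.le
      have h4 := mul_le_mul_of_nonneg_right hwS.le hR.le
      exact abs_le.2 ⟨by linarith, by linarith⟩
    · push Not at hab
      obtain ⟨rfl, rfl⟩ := hab
      rw [Finset.filter_false_of_mem]
      · simp
      · rintro x - ⟨⟨z, -, hz⟩, w, -, hw⟩
        simp only [Set.mem_ofPred_eq, zero_mul, add_zero] at hz hw
        exact hw hz
  | compl _ ih =>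
    refine le_trans (Finset.card_le_card ?_) ih
    refine Finset.monotone_filter_right _ fun x _ hx => ?_
    obtain ⟨h1, z, hz, hzS⟩ := hx
    exact ⟨⟨z, hz, not_not.1 hzS⟩, h1⟩
  | @inter k l S S' _ _ ih ih' =>
    calc _ ≤ ((I ×ˢ J).filter (Mixed S R) ∪ (I ×ˢ J).filter (Mixed S' R)).card := by
          refine Finset.card_le_card fun x hx => ?_
          obtain ⟨hx, ⟨z, hz, hzS⟩, w, hw, hwS⟩ := Finset.mem_filter.1 hx
          rw [Finset.mem_union, Finset.mem_filter, Finset.mem_filter]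
          by_cases hw1 : w ∈ S
          · exact Or.inr ⟨hx, ⟨z, hz, hzS.2⟩, w, hw, fun hw2 => hwS ⟨hw1, hw2⟩⟩
          · exact Or.inl ⟨hx, ⟨z, hz, hzS.1⟩, w, hw, hw1⟩
      _ ≤ _ := Finset.card_union_le _ _
      _ ≤ 5 * (k + l) * (I.card + J.card) := by linarith

open Classical in
/-- Counting lattice points of a polygonal set approximates its area, with an error bounded by
the perimeter of a box containing the set. -/
lemma abs_card_sub_area_le {k : ℕ} {S : Set (ℝ × ℝ)} (h : Polygonal k S) {R : ℝ} (hR : 0 < R)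
    (I J : Finset ℤ) (hIJ : ∀ z ∈ S, ⌈R * z.1⌉ ∈ I ∧ ⌈R * z.2⌉ ∈ J) :
    |((((I ×ˢ J).filter fun x => scaled R x ∈ S).card : ℕ) : ℝ) - R ^ 2 * volume.real S| ≤
      5 * k * (I.card + J.card) := by
  have hfin : ∀ x, volume (cell R x) ≠ ⊤ := fun x => by
    rw [volume_cell hR]; exact ENNReal.ofReal_ne_top
  have hcell : ∀ x, volume.real (cell R x) = 1 / R ^ 2 := fun x => by
    rw [Measure.real, volume_cell hR, ENNReal.toReal_ofReal (by positivity)]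
  have hS : S = ⋃ x ∈ I ×ˢ J, S ∩ cell R x := by
    ext z
    simp only [Set.mem_iUnion, Set.mem_inter_iff]
    constructor
    · intro hz
      exact ⟨(⌈R * z.1⌉, ⌈R * z.2⌉), Finset.mem_product.2 (hIJ z hz), hz,
        (mem_cell hR).2 ⟨rfl, rfl⟩⟩
    · rintro ⟨_, _, hz, _⟩
      exact hz
  have harea : volume.real S = ∑ x ∈ I ×ˢ J, volume.real (S ∩ cell R x) := by
    conv_lhs => rw [hS]
    refine measureReal_biUnion_finset ?_ (fun x _ => h.measurableSet.inter (measurableSet_cell R x))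
      (fun x _ => measure_ne_top_of_subset Set.inter_subset_right (hfin x))
    intro x _ y _ hxy
    refine Set.disjoint_left.2 fun z hz hz' => hxy ?_
    have h1 := (mem_cell hR).1 hz.2
    have h2 := (mem_cell hR).1 hz'.2
    exact Prod.ext (h1.1.trans h2.1.symm) (h1.2.trans h2.2.symm)
  rw [harea, Finset.card_filter, Nat.cast_sum, Finset.mul_sum, ← Finset.sum_sub_distrib]
  refine (Finset.abs_sum_le_sum_abs _ _).trans ?_
  have hterm : ∀ x ∈ I ×ˢ J, |(((if scaled R x ∈ S then 1 else 0 : ℕ)) : ℝ) -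
      R ^ 2 * volume.real (S ∩ cell R x)| ≤ if Mixed S R x then 1 else 0 := by
    intro x _
    have hle : volume.real (S ∩ cell R x) ≤ 1 / R ^ 2 := by
      rw [← hcell x]
      exact measureReal_mono Set.inter_subset_right (hfin x)
    have h0 : 0 ≤ R ^ 2 * volume.real (S ∩ cell R x) := by positivity
    have h1 : R ^ 2 * volume.real (S ∩ cell R x) ≤ 1 := by
      calc _ ≤ R ^ 2 * (1 / R ^ 2) := by gcongr
        _ = 1 := by field_simp
    by_cases hm : Mixed S R x
    · rw [if_pos hm]
      split_ifs <;> rw [abs_le] <;> constructor <;> push_cast <;> linarith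
    · rw [if_neg hm]
      have hsc := scaled_mem_cell hR x
      by_cases hx : scaled R x ∈ S
      · have : S ∩ cell R x = cell R x := by
          refine Set.inter_eq_right.2 fun z hz => ?_
          by_contra hzS
          exact hm ⟨⟨_, hsc, hx⟩, z, hz, hzS⟩
        rw [this, hcell, if_pos hx]
        field_simp
        simp
      · have : S ∩ cell R x = ∅ := by
          refine Set.eq_empty_iff_forall_notMem.2 fun z hz => ?_
          exact hm ⟨⟨z, hz.2, hz.1⟩, _, hsc, hx⟩
        rw [this, if_neg hx]
        simp
  refine (Finset.sum_le_sum hterm).trans ?_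
  rw [← Finset.sum_filter, Finset.sum_const, nsmul_eq_mul, mul_one]
  exact_mod_cast h.card_mixed_le hR I J

/-! ### Counting coprime lattice points -/

/-- The pairs of coprime integers `1 ≤ a, b ≤ Q` with `a + b > Q`; these are the pairs of
denominators of consecutive Farey fractions of order `Q`. -/
def pairs (Q : ℕ) : Finset (ℤ × ℤ) :=
  (Finset.Icc (1 : ℤ) Q ×ˢ Finset.Icc (1 : ℤ) Q).filter
    fun x => Int.gcd x.1 x.2 = 1 ∧ (Q : ℤ) < x.1 + x.2

/-- The sum of `f` over the points of `pairs Q` scaled into the Farey triangle. -/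
def cnt (Q : ℕ) (f : ℝ × ℝ → ℝ) : ℝ := ∑ x ∈ pairs Q, f (scaled Q x)

/-- The density `∑ μ(d) / d² = 6 / π²` of coprime pairs. -/
def density : ℝ := ∑' d : ℕ, (ArithmeticFunction.moebius d : ℝ) / (d : ℝ) ^ 2

lemma abs_moebius_div_sq_le (d : ℕ) :
    |(ArithmeticFunction.moebius d : ℝ) / (d : ℝ) ^ 2| ≤ ((d : ℝ) ^ 2)⁻¹ := by
  have h : |(ArithmeticFunction.moebius d : ℝ)| ≤ 1 := by
    exact_mod_cast ArithmeticFunction.abs_moebius_le_one (n := d)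
  rw [abs_div, abs_of_nonneg (sq_nonneg (d : ℝ)), div_eq_mul_inv]
  exact mul_le_of_le_one_left (by positivity) h

lemma summable_moebius_div_sq :
    Summable fun d : ℕ => (ArithmeticFunction.moebius d : ℝ) / (d : ℝ) ^ 2 :=
  Summable.of_norm_bounded (Real.summable_nat_pow_inv.2 (by norm_num : 1 < 2))
    abs_moebius_div_sq_le

lemma abs_density_sub_le (Q : ℕ) :
    |density - ∑ d ∈ Finset.Icc 1 Q, (ArithmeticFunction.moebius d : ℝ) / (d : ℝ) ^ 2| ≤
      2 / ((Q : ℝ) + 1) := by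
  have hrange : ∑ d ∈ Finset.Icc 1 Q, (ArithmeticFunction.moebius d : ℝ) / (d : ℝ) ^ 2 =
      ∑ d ∈ Finset.range (Q + 1), (ArithmeticFunction.moebius d : ℝ) / (d : ℝ) ^ 2 := by
    rw [Finset.sum_range_eq_add_Ico _ (by omega)]
    simp
    rfl
  rw [hrange]
  have hlim := (summable_moebius_div_sq.hasSum.tendsto_sum_nat.sub_const
    (∑ d ∈ Finset.range (Q + 1), (ArithmeticFunction.moebius d : ℝ) / (d : ℝ) ^ 2)).abs
  refine le_of_tendsto hlim ?_
  filter_upwards [eventually_ge_atTop (Q + 1)] with n hn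
  rw [← Finset.sum_Ico_eq_sub _ hn]
  refine (Finset.abs_sum_le_sum_abs _ _).trans ?_
  refine (Finset.sum_le_sum fun d _ => abs_moebius_div_sq_le d).trans ?_
  have : Finset.Ico (Q + 1) n = Finset.Ioo Q n := by
    ext; simp
  rw [this]
  exact sum_Ioo_inv_sq_le Q n

lemma density_pos : 0 < density := by
  have h := abs_le.1 (abs_density_sub_le 3)
  have h2 : ArithmeticFunction.moebius 2 = -1 :=
    ArithmeticFunction.moebius_apply_prime Nat.prime_two
  have h3 : ArithmeticFunction.moebius 3 = -1 :=
    ArithmeticFunction.moebius_apply_prime Nat.prime_three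
  have hs : ∑ d ∈ Finset.Icc 1 3, (ArithmeticFunction.moebius d : ℝ) / (d : ℝ) ^ 2 =
      1 - 1 / 4 - 1 / 9 := by
    rw [show Finset.Icc 1 3 = {1, 2, 3} from rfl, Finset.sum_insert (by decide),
      Finset.sum_insert (by decide), Finset.sum_singleton, h2, h3]
    norm_num
  rw [hs] at h
  norm_num at h
  linarith [h.1]

/-- The number of lattice points in the dilate `R • S`. -/
def lattice (R : ℝ) (S : Set (ℝ × ℝ)) : ℕ := Set.ncard {x : ℤ × ℤ | scaled R x ∈ S}

lemma sum_Icc_inv_le (Q : ℕ) : ∑ d ∈ Finset.Icc 1 Q, ((d : ℝ))⁻¹ ≤ 1 + Real.log Q := by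
  have h := harmonic_le_one_add_log Q
  rw [harmonic_eq_sum_Icc] at h
  push_cast at h
  exact h

open Classical in
/-- Möbius inversion: the coprime points of a subset of the Farey triangle. -/
lemma cnt_indicator_eq {S : Set (ℝ × ℝ)} (hS : S ⊆ triangle) {Q : ℕ} (hQ : 1 ≤ Q) :
    cnt Q (S.indicator 1) =
      ∑ d ∈ Finset.Icc 1 Q, (ArithmeticFunction.moebius d : ℝ) * lattice ((Q : ℝ) / d) S := by
  have hQ0 : (0 : ℝ) < Q := by exact_mod_cast hQ
  set B : Finset (ℤ × ℤ) := Finset.Icc (1 : ℤ) Q ×ˢ Finset.Icc (1 : ℤ) Q with hB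
  -- lattice points of the dilated set lie in the box `B`
  have hbox : ∀ R : ℝ, 0 < R → R ≤ Q → ∀ x : ℤ × ℤ, scaled R x ∈ S → x ∈ B := by
    intro R hR hRQ x hx
    obtain ⟨⟨h1, h2⟩, ⟨h3, h4⟩, -⟩ := mem_triangle.1 (hS hx)
    simp only [scaled] at h1 h2 h3 h4
    rw [div_pos_iff_of_pos_right hR] at h1 h3
    rw [div_le_one hR] at h2 h4
    have a1 : 0 < x.1 := by exact_mod_cast h1
    have a2 : 0 < x.2 := by exact_mod_cast h3
    have a3 : x.1 ≤ Q := by exact_mod_cast h2.trans hRQ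
    have a4 : x.2 ≤ Q := by exact_mod_cast h4.trans hRQ
    rw [hB, Finset.mem_product, Finset.mem_Icc, Finset.mem_Icc]
    omega
  have h_sum : cnt Q (S.indicator 1) = ∑ x ∈ B.filter (fun x => scaled Q x ∈ S),
      if Int.gcd x.1 x.2 = 1 then (1 : ℝ) else 0 := by
    rw [cnt, pairs, Finset.sum_filter, Finset.sum_filter]
    refine Finset.sum_congr rfl fun x _ => ?_
    by_cases hx : scaled Q x ∈ S
    · have hlt : (Q : ℤ) < x.1 + x.2 := by
        have := (mem_triangle.1 (hS hx)).2.2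
        simp only [scaled] at this
        rw [← add_div, lt_div_iff₀ hQ0, one_mul] at this
        exact_mod_cast this
      simp [hx, hlt]
    · simp [hx]
  have h_moebius : ∀ x ∈ B, (if Int.gcd x.1 x.2 = 1 then (1 : ℝ) else 0) =
      ∑ d ∈ Finset.Icc 1 Q, if (d : ℤ) ∣ x.1 ∧ (d : ℤ) ∣ x.2 then
        (ArithmeticFunction.moebius d : ℝ) else 0 := by
    intro x hx
    rw [hB, Finset.mem_product, Finset.mem_Icc, Finset.mem_Icc] at hx
    have hg : 0 < Int.gcd x.1 x.2 := Int.gcd_pos_of_ne_zero_left _ (by omega)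
    have h := congrArg (fun f => f (Int.gcd x.1 x.2))
      ArithmeticFunction.coe_zeta_mul_moebius
    simp only [ArithmeticFunction.coe_zeta_mul_apply, ArithmeticFunction.one_apply] at h
    have h' := congrArg (fun t : ℤ => (t : ℝ)) h
    push_cast at h'
    rw [← h', ← Finset.sum_filter]
    refine Finset.sum_congr ?_ fun _ _ => rfl
    ext d
    rw [Nat.mem_divisors, Finset.mem_filter, Finset.mem_Icc, Int.natCast_dvd, Int.natCast_dvd,
      Int.gcd, Nat.dvd_gcd_iff]
    constructor
    · rintro ⟨hd, -⟩
      have := Nat.pos_of_dvd_of_pos hd.1 (by omega)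
      have := Nat.le_of_dvd (by omega) hd.1
      exact ⟨by omega, hd⟩
    · rintro ⟨-, hd⟩
      exact ⟨hd, hg.ne'⟩
  have h_card : ∀ d ∈ Finset.Icc 1 Q,
      ((B.filter fun x => scaled Q x ∈ S).filter fun x => (d : ℤ) ∣ x.1 ∧ (d : ℤ) ∣ x.2).card =
        lattice ((Q : ℝ) / d) S := by
    intro d hd
    rw [Finset.mem_Icc] at hd
    have hd0 : (0 : ℝ) < d := by exact_mod_cast hd.1
    have hdz : (d : ℤ) ≠ 0 := by omega
    have hsc : ∀ x : ℤ × ℤ, scaled Q ((d : ℤ) * x.1, (d : ℤ) * x.2) = scaled ((Q : ℝ) / d) x := by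
      intro x
      simp only [scaled]
      push_cast
      congr 1 <;> field_simp
    rw [lattice, ← Set.ncard_coe_finset]
    symm
    refine Set.ncard_congr (fun x _ => ((d : ℤ) * x.1, (d : ℤ) * x.2)) ?_ ?_ ?_
    · intro x hx
      rw [Set.mem_ofPred_eq, ← hsc] at hx
      simp only [Finset.coe_filter, Set.mem_ofPred_eq, Finset.mem_filter]
      exact ⟨⟨hbox Q hQ0 le_rfl _ hx, hx⟩, dvd_mul_right _ _, dvd_mul_right _ _⟩
    · intro x y _ _ hxy
      simp only [Prod.mk.injEq, mul_eq_mul_left_iff, hdz, or_false] at hxy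
      exact Prod.ext hxy.1 hxy.2
    · rintro ⟨_, _⟩ hx
      simp only [Finset.coe_filter, Set.mem_ofPred_eq, Finset.mem_filter] at hx
      obtain ⟨⟨_, hx⟩, ⟨a, rfl⟩, b, rfl⟩ := hx
      exact ⟨(a, b), by rw [Set.mem_ofPred_eq, ← hsc]; exact hx, rfl⟩
  rw [h_sum, Finset.sum_congr rfl fun x hx => h_moebius x (Finset.mem_filter.1 hx).1,
    Finset.sum_comm]
  refine Finset.sum_congr rfl fun d hd => ?_
  rw [← Finset.sum_filter, Finset.sum_const, h_card d hd, nsmul_eq_mul, mul_comm]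

/-- A lattice point count with error `O(R)` gives a count of coprime points with
error `O(Q log Q)`. -/
lemma abs_cnt_indicator_sub_le {S : Set (ℝ × ℝ)} (hS : S ⊆ triangle) {E : ℝ}
    (hE : ∀ R : ℝ, 1 ≤ R → |(lattice R S : ℝ) - R ^ 2 * volume.real S| ≤ E * R)
    {Q : ℕ} (hQ : 1 ≤ Q) :
    |cnt Q (S.indicator 1) - density * Q ^ 2 * volume.real S| ≤
      E * Q * (1 + Real.log Q) + 2 * Q * volume.real S := by
  have hQ0 : (0 : ℝ) < Q := by exact_mod_cast hQ
  have hE0 : 0 ≤ E := by simpa using (abs_nonneg _).trans (hE 1 le_rfl)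
  rw [cnt_indicator_eq hS hQ]
  set M := ∑ d ∈ Finset.Icc 1 Q, (ArithmeticFunction.moebius d : ℝ) / (d : ℝ) ^ 2 with hM
  have h1 : |∑ d ∈ Finset.Icc 1 Q, (ArithmeticFunction.moebius d : ℝ) * lattice ((Q : ℝ) / d) S -
      M * Q ^ 2 * volume.real S| ≤ E * Q * (1 + Real.log Q) := by
    rw [hM, Finset.sum_mul, Finset.sum_mul, ← Finset.sum_sub_distrib]
    refine (Finset.abs_sum_le_sum_abs _ _).trans ?_
    have hterm : ∀ d ∈ Finset.Icc 1 Q, |(ArithmeticFunction.moebius d : ℝ) *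
        lattice ((Q : ℝ) / d) S - (ArithmeticFunction.moebius d : ℝ) / (d : ℝ) ^ 2 * Q ^ 2 *
          volume.real S| ≤ E * Q * (d : ℝ)⁻¹ := by
      intro d hd
      rw [Finset.mem_Icc] at hd
      have hd0 : (0 : ℝ) < d := by exact_mod_cast hd.1
      have hdQ : (d : ℝ) ≤ Q := by exact_mod_cast hd.2
      have hmu : |(ArithmeticFunction.moebius d : ℝ)| ≤ 1 := by
        exact_mod_cast ArithmeticFunction.abs_moebius_le_one (n := d)
      have e : (ArithmeticFunction.moebius d : ℝ) * lattice ((Q : ℝ) / d) S -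
          (ArithmeticFunction.moebius d : ℝ) / (d : ℝ) ^ 2 * Q ^ 2 * volume.real S =
          (ArithmeticFunction.moebius d : ℝ) *
            (lattice ((Q : ℝ) / d) S - ((Q : ℝ) / d) ^ 2 * volume.real S) := by
        field_simp
      rw [e, abs_mul]
      refine (mul_le_of_le_one_left (abs_nonneg _) hmu).trans ?_
      refine (hE _ ((one_le_div hd0).2 hdQ)).trans (le_of_eq ?_)
      rw [div_eq_mul_inv, mul_assoc]
    refine (Finset.sum_le_sum hterm).trans ?_
    rw [← Finset.mul_sum]
    exact mul_le_mul_of_nonneg_left (sum_Icc_inv_le Q) (by positivity)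
  have h2 : |M * Q ^ 2 * volume.real S - density * Q ^ 2 * volume.real S| ≤
      2 * Q * volume.real S := by
    have e : M * Q ^ 2 * volume.real S - density * Q ^ 2 * volume.real S =
      -((density - M) * (Q ^ 2 * volume.real S)) := by ring
    have hV : 0 ≤ (Q : ℝ) ^ 2 * volume.real S := by positivity
    rw [e, abs_neg, abs_mul, abs_of_nonneg hV]
    calc _ ≤ 2 / ((Q : ℝ) + 1) * (Q ^ 2 * volume.real S) := by
          gcongr
          exact abs_density_sub_le Q
      _ ≤ 2 / (Q : ℝ) * (Q ^ 2 * volume.real S) := by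
          gcongr
          linarith
      _ = 2 * Q * volume.real S := by field_simp
  calc _ ≤ _ := abs_sub_le _ (M * Q ^ 2 * volume.real S) _
    _ ≤ _ := add_le_add h1 h2

/-! ### Consecutive Farey fractions -/

lemma mem_farey {Q : ℕ} {r : ℚ} : r ∈ farey Q ↔ 0 < r ∧ r ≤ 1 ∧ r.den ≤ Q := by
  simp only [farey, Finset.mem_image, Finset.mem_filter, Finset.mem_product, Finset.mem_Icc,
    Prod.exists]
  constructor
  · rintro ⟨a, b, ⟨⟨⟨ha, -⟩, hb, hbQ⟩, hab, hcop⟩, rfl⟩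
    have hb0 : (0 : ℚ) < b := by exact_mod_cast hb
    have ha0 : (0 : ℚ) < a := by exact_mod_cast ha
    refine ⟨by positivity, (div_le_one hb0).2 (by exact_mod_cast hab), ?_⟩
    have := Rat.den_div_eq_of_coprime (a := (a : ℤ)) (b := (b : ℤ)) (by exact_mod_cast hb)
      (by simpa using hcop)
    push_cast at this
    omega
  · rintro ⟨h0, h1, hQ⟩
    have hn : 0 < r.num := Rat.num_pos.2 h0
    have hle : r.num ≤ r.den := by
      rw [← Rat.num_div_den r, div_le_one (by exact_mod_cast r.pos)] at h1
      exact_mod_cast h1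
    have hd := r.pos
    refine ⟨r.num.natAbs, r.den, ⟨⟨⟨by omega, by omega⟩, hd, hQ⟩, by omega, r.reduced⟩, ?_⟩
    have : ((r.num.natAbs : ℕ) : ℚ) = (r.num : ℚ) := by
      rw [← Int.cast_natCast, Int.natAbs_of_nonneg hn.le]
    rw [this, Rat.num_div_den]

lemma N_pos {Q : ℕ} (hQ : 1 ≤ Q) : 0 < N Q :=
  Finset.card_pos.2 ⟨1, mem_farey.2 ⟨one_pos, le_rfl, by simpa using hQ⟩⟩

/-- The Farey fractions of order `Q` in increasing order. -/
def fareyList (Q : ℕ) : List ℚ := (farey Q).sort (· ≤ ·)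

lemma length_fareyList (Q : ℕ) : (fareyList Q).length = N Q := Finset.length_sort _

lemma gam_eq {Q : ℕ} (t : ℤ) {s : ℕ} (hs : s < (fareyList Q).length) :
    gam Q ((N Q : ℤ) * t + s + 1) = (fareyList Q)[s] + (t : ℚ) := by
  have hs' := hs
  rw [length_fareyList] at hs'
  have h1 : ((N Q : ℤ) * t + s + 1 - 1) % (N Q : ℤ) = s := by
    rw [add_sub_cancel_right, Int.mul_add_emod_self_left,
      Int.emod_eq_of_lt (by omega) (by omega)]
  have h2 : ((N Q : ℤ) * t + s + 1 - 1) / (N Q : ℤ) = t := by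
    rw [add_sub_cancel_right, Int.mul_add_ediv_left _ _ (by omega),
      Int.ediv_eq_zero_of_lt (by omega) (by omega), add_zero]
  rw [gam, h1, h2, Int.toNat_natCast]
  congr 1
  exact List.getD_eq_getElem _ _ hs

lemma exists_index {Q : ℕ} (hQ : 1 ≤ Q) (i : ℤ) :
    ∃ (t : ℤ) (s : ℕ), s < (fareyList Q).length ∧ i = (N Q : ℤ) * t + s + 1 := by
  have hN := N_pos hQ
  have h1 := Int.emod_nonneg (i - 1) (b := (N Q : ℤ)) (by omega)
  have h2 := Int.emod_lt_of_pos (i - 1) (b := (N Q : ℤ)) (by omega)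
  have h3 := Int.mul_ediv_add_emod (i - 1) (N Q)
  refine ⟨(i - 1) / N Q, ((i - 1) % N Q).toNat, by rw [length_fareyList]; omega, ?_⟩
  rw [Int.toNat_of_nonneg h1]
  omega

lemma getElem_fareyList {Q s : ℕ} (hs : s < (fareyList Q).length) :
    0 < (fareyList Q)[s] ∧ (fareyList Q)[s] ≤ 1 ∧ (fareyList Q)[s].den ≤ Q :=
  mem_farey.1 ((Finset.mem_sort _).1 (List.getElem_mem hs))

lemma den_add_int (r : ℚ) (t : ℤ) : (r + t).den = r.den := by
  simp

lemma gam_den_le {Q : ℕ} (hQ : 1 ≤ Q) (i : ℤ) : (gam Q i).den ≤ Q := by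
  obtain ⟨t, s, hs, rfl⟩ := exists_index hQ i
  rw [gam_eq t hs, den_add_int]
  exact (getElem_fareyList hs).2.2

lemma gam_strictMono {Q : ℕ} (hQ : 1 ≤ Q) : StrictMono (gam Q) := by
  refine strictMono_int_of_lt_succ fun i => ?_
  obtain ⟨t, s, hs, rfl⟩ := exists_index hQ i
  have hN := N_pos hQ
  have hl := length_fareyList Q
  by_cases h : s + 1 < (fareyList Q).length
  · have := gam_eq t h
    push_cast at this
    rw [← add_assoc] at this
    rw [this, gam_eq t hs]
    have hsort : (fareyList Q).SortedLT := Finset.sortedLT_sort _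
    have := hsort.getElem_lt_getElem_of_lt (i := s) (j := s + 1) (hi := hs) (hj := h) (by omega)
    gcongr
  · have h0 : 0 < (fareyList Q).length := by omega
    have he : (N Q : ℤ) * t + s + 1 + 1 = (N Q : ℤ) * (t + 1) + (0 : ℕ) + 1 := by
      have : (s : ℤ) + 1 = N Q := by omega
      push_cast
      linarith
    rw [he, gam_eq t hs, gam_eq (t + 1) h0]
    have h1 := (getElem_fareyList hs).2.1
    have h2 := (getElem_fareyList h0).1
    push_cast
    linarith

lemma exists_gam_eq {Q : ℕ} {r : ℚ} (hr : r.den ≤ Q) : ∃ i, gam Q i = r := by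
  have hmem : r - (⌈r⌉ - 1 : ℤ) ∈ farey Q := by
    have h1 := Int.le_ceil r
    have h2 := Int.ceil_lt_add_one r
    refine mem_farey.2 ⟨?_, ?_, ?_⟩
    · push_cast; linarith
    · push_cast; linarith
    · rwa [sub_eq_add_neg, ← Int.cast_neg, den_add_int]
  obtain ⟨s, hs, h⟩ := List.getElem_of_mem ((Finset.mem_sort (· ≤ ·)).2 hmem)
  refine ⟨(N Q : ℤ) * (⌈r⌉ - 1) + s + 1, ?_⟩
  rw [gam_eq _ hs]
  exact (congrArg (· + _) h).trans (by push_cast; ring)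

lemma gam_add_N {Q : ℕ} (hQ : 1 ≤ Q) (i : ℤ) : gam Q (i + N Q) = gam Q i + 1 := by
  obtain ⟨t, s, hs, rfl⟩ := exists_index hQ i
  have he : (N Q : ℤ) * t + s + 1 + N Q = (N Q : ℤ) * (t + 1) + s + 1 := by ring
  rw [he, gam_eq _ hs, gam_eq _ hs]
  push_cast
  ring

lemma q_pos (Q : ℕ) (i : ℤ) : 0 < q Q i := by
  have := (gam Q i).pos
  simpa [q] using this

lemma q_le {Q : ℕ} (hQ : 1 ≤ Q) (i : ℤ) : q Q i ≤ Q := by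
  have := gam_den_le hQ i
  simpa [q] using this

lemma q_add_N {Q : ℕ} (hQ : 1 ≤ Q) (i : ℤ) : q Q (i + N Q) = q Q i := by
  rw [q, q, gam_add_N hQ]
  have := den_add_int (gam Q i) 1
  push_cast at this
  rw [this]

lemma gam_eq_div (Q : ℕ) (i : ℤ) : gam Q i = (p Q i : ℚ) / (q Q i : ℚ) := by
  simp [p, q, Rat.num_div_den]

lemma isCoprime_p_q (Q : ℕ) (i : ℤ) : IsCoprime (p Q i) (q Q i) :=
  Rat.isCoprime_num_den (gam Q i)

/-- An integer `v` solving `u q - p v = 1` can be found in any interval of length `q`. -/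
lemma exists_det_one {a b : ℤ} (hab : IsCoprime a b) (hb : 0 < b) (Q : ℤ) :
    ∃ u v : ℤ, u * b - a * v = 1 ∧ Q - b < v ∧ v ≤ Q := by
  obtain ⟨x, y, h⟩ := hab
  have h1 := Int.emod_nonneg (Q + x) hb.ne'
  have h2 := Int.emod_lt_of_pos (Q + x) hb
  have h3 := Int.mul_ediv_add_emod (Q + x) b
  refine ⟨y + a * ((Q + x) / b), -x + b * ((Q + x) / b), ?_, by linarith, by linarith⟩
  linear_combination h

/-- The successor of `p / q` among the fractions of order `Q` is the fraction `u / v` with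
`u q - p v = 1` and `v` as large as possible. -/
lemma consecutive {Q : ℕ} (hQ : 1 ≤ Q) (i : ℤ) :
    p Q (i + 1) * q Q i - p Q i * q Q (i + 1) = 1 ∧ (Q : ℤ) < q Q i + q Q (i + 1) := by
  have hq := q_pos Q i
  have hqQ := q_le hQ i
  obtain ⟨u, v, huv, hv1, hv2⟩ := exists_det_one (isCoprime_p_q Q i) hq Q
  have hv0 : 0 < v := by linarith
  have hcop : Nat.Coprime u.natAbs v.natAbs := by
    rw [← Int.isCoprime_iff_nat_coprime]
    exact ⟨q Q i, -p Q i, by linear_combination huv⟩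
  have hden := Rat.den_div_eq_of_coprime hv0 hcop
  have hnum := Rat.num_div_eq_of_coprime hv0 hcop
  obtain ⟨j, hj⟩ := exists_gam_eq (Q := Q) (r := (u : ℚ) / v) (by omega)
  have hq0 : (0 : ℚ) < q Q i := by exact_mod_cast hq
  have hvq : (0 : ℚ) < v := by exact_mod_cast hv0
  have hq1 := q_pos Q (i + 1)
  have hq1q : (0 : ℚ) < q Q (i + 1) := by exact_mod_cast hq1
  have hlt : gam Q i < gam Q j := by
    rw [hj, gam_eq_div, div_lt_div_iff₀ hq0 hvq]
    have : p Q i * v < u * q Q i := by linarith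
    exact_mod_cast this
  have hij : i + 1 ≤ j := (gam_strictMono hQ).lt_iff_lt.1 hlt
  rcases hij.eq_or_lt with h | h
  · have e1 : p Q (i + 1) = u := by rw [h, p, hj, hnum]
    have e2 : q Q (i + 1) = v := by rw [h, q, hj, hden]
    rw [e1, e2]
    exact ⟨huv, by linarith⟩
  · exfalso
    have l1 := gam_strictMono hQ (show i < i + 1 by omega)
    have l2 := gam_strictMono hQ h
    rw [gam_eq_div, gam_eq_div Q (i + 1), div_lt_div_iff₀ hq0 hq1q] at l1
    rw [hj, gam_eq_div, div_lt_div_iff₀ hq1q hvq] at l2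
    have l1' : p Q i * q Q (i + 1) + 1 ≤ p Q (i + 1) * q Q i := by exact_mod_cast l1
    have l2' : p Q (i + 1) * v + 1 ≤ u * q Q (i + 1) := by exact_mod_cast l2
    -- comparing the two gaps with the total gap `1 / (q v)` gives `q + v ≤ q' ≤ Q`
    have hle := q_le hQ (i + 1)
    nlinarith

/-- The index `(q_{i-1} + q_{i+1}) / q_i` of a Farey fraction. -/
lemma exists_index_mul {Q : ℕ} (hQ : 1 ≤ Q) (i : ℤ) :
    ∃ a : ℤ, q Q (i - 1) + q Q (i + 1) = a * q Q i ∧ p Q (i - 1) + p Q (i + 1) = a * p Q i := by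
  have h1 := (consecutive hQ i).1
  have h2 := (consecutive hQ (i - 1)).1
  rw [sub_add_cancel] at h2
  have h : (p Q (i - 1) + p Q (i + 1)) * q Q i = p Q i * (q Q (i - 1) + q Q (i + 1)) := by
    linear_combination h1 - h2
  obtain ⟨a, ha⟩ := (isCoprime_p_q Q i).symm.dvd_of_dvd_mul_left (Dvd.intro_left _ h)
  refine ⟨a, by rw [ha]; ring, ?_⟩
  have hq := (q_pos Q i).ne'
  refine mul_right_cancel₀ hq ?_
  rw [h, ha]
  ring

/-- The point of the Farey triangle attached to `γ_{i-1}` and `γ_i`. -/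
def point (Q : ℕ) (i : ℤ) : ℝ × ℝ := scaled Q (q Q (i - 1), q Q i)

lemma point_mem {Q : ℕ} (hQ : 1 ≤ Q) (i : ℤ) : point Q i ∈ triangle := by
  have hQ0 : (0 : ℝ) < Q := by exact_mod_cast hQ
  have h := (consecutive hQ (i - 1)).2
  rw [sub_add_cancel] at h
  rw [mem_triangle, point, scaled]
  simp only
  rw [← add_div, one_lt_div hQ0, div_le_one hQ0, div_le_one hQ0]
  refine ⟨⟨div_pos ?_ hQ0, ?_⟩, ⟨div_pos ?_ hQ0, ?_⟩, ?_⟩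
  · exact_mod_cast q_pos Q _
  · exact_mod_cast q_le hQ _
  · exact_mod_cast q_pos Q _
  · exact_mod_cast q_le hQ _
  · exact_mod_cast h

lemma q_add_q {Q : ℕ} (hQ : 1 ≤ Q) (i : ℤ) :
    q Q (i - 1) + q Q (i + 1) = (idx (point Q i) : ℤ) * q Q i ∧
      p Q (i - 1) + p Q (i + 1) = (idx (point Q i) : ℤ) * p Q i := by
  have hQ0 : (0 : ℝ) < Q := by exact_mod_cast hQ
  obtain ⟨a, ha, ha'⟩ := exists_index_mul hQ i
  have hq := q_pos Q i
  have h1 := q_pos Q (i - 1)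
  have h2 := q_pos Q (i + 1)
  have h3 := (consecutive hQ i).2
  have h4 := q_le hQ (i + 1)
  have ha0 : 0 < a := by
    by_contra! h
    nlinarith
  lift a to ℕ using ha0.le
  have : idx (point Q i) = a := by
    rw [idx_eq_iff (point_mem hQ i), point, scaled]
    simp only
    have e1 : (a : ℝ) * q Q i ≤ Q + q Q (i - 1) := by
      have : (a : ℤ) * q Q i ≤ Q + q Q (i - 1) := by linarith
      exact_mod_cast this
    have e2 : (Q : ℝ) + q Q (i - 1) < (a + 1) * q Q i := by
      have : (Q : ℤ) + q Q (i - 1) < (a + 1) * q Q i := by linarith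
      exact_mod_cast this
    rw [← mul_div_assoc, ← mul_div_assoc, one_add_div hQ0.ne', div_le_div_iff_of_pos_right hQ0,
      div_lt_div_iff_of_pos_right hQ0]
    exact ⟨e1, e2⟩
  rw [this]
  exact ⟨ha, ha'⟩

lemma T_point {Q : ℕ} (hQ : 1 ≤ Q) (i : ℤ) : T (point Q i) = point Q (i + 1) := by
  rw [T_eq (point_mem hQ i), reflect]
  have h : (q Q (i - 1) : ℝ) + q Q (i + 1) = idx (point Q i) * q Q i := by
    exact_mod_cast (q_add_q hQ i).1
  rw [point] at h ⊢
  simp only [point, scaled, Prod.swap, add_sub_cancel_right] at h ⊢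
  congr 1
  rw [← mul_div_assoc, ← sub_div, ← h, add_sub_cancel_left]

lemma iterate_T_point {Q : ℕ} (hQ : 1 ≤ Q) (i : ℤ) (n : ℕ) :
    T^[n] (point Q i) = point Q (i + n) := by
  induction n with
  | zero => simp
  | succ n ih =>
    rw [Function.iterate_succ_apply', ih, T_point hQ]
    push_cast
    rw [add_assoc]

/-- The pairs of denominators of consecutive Farey fractions are exactly the coprime pairs
`(a, b)` with `a, b ≤ Q < a + b`. -/
lemma sum_point {Q : ℕ} (hQ : 1 ≤ Q) (f : ℝ × ℝ → ℝ) :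
    ∑ i ∈ Finset.Icc (1 : ℤ) (N Q), f (point Q i) = cnt Q f := by
  have hrange : ∀ i ∈ Finset.Icc (1 : ℤ) (N Q), 0 < gam Q i ∧ gam Q i ≤ 1 := by
    intro i hi
    rw [Finset.mem_Icc] at hi
    have hs : (i - 1).toNat < (fareyList Q).length := by rw [length_fareyList]; omega
    have he : i = (N Q : ℤ) * 0 + ((i - 1).toNat : ℕ) + 1 := by omega
    rw [he, gam_eq 0 hs]
    rw [Int.cast_zero, add_zero]
    exact ⟨(getElem_fareyList hs).1, (getElem_fareyList hs).2.1⟩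
  have hp : ∀ i ∈ Finset.Icc (1 : ℤ) (N Q), 0 < p Q i ∧ p Q i ≤ q Q i := by
    intro i hi
    obtain ⟨h1, h2⟩ := hrange i hi
    have hq : (0 : ℚ) < q Q i := by exact_mod_cast q_pos Q i
    rw [gam_eq_div] at h1 h2
    rw [div_pos_iff_of_pos_right hq] at h1
    rw [div_le_one hq] at h2
    exact ⟨by exact_mod_cast h1, by exact_mod_cast h2⟩
  have hdet : ∀ i, p Q i * q Q (i - 1) - p Q (i - 1) * q Q i = 1 := by
    intro i
    have := (consecutive hQ (i - 1)).1
    rwa [sub_add_cancel] at this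
  refine Finset.sum_bij (fun i _ => (q Q (i - 1), q Q i)) ?_ ?_ ?_ ?_
  · intro i _
    have h := (consecutive hQ (i - 1)).2
    rw [sub_add_cancel] at h
    simp only [pairs, Finset.mem_filter, Finset.mem_product, Finset.mem_Icc]
    refine ⟨⟨⟨q_pos Q _, q_le hQ _⟩, q_pos Q _, q_le hQ _⟩, ?_, h⟩
    rw [← Int.isCoprime_iff_gcd_eq_one]
    exact ⟨p Q i, -p Q (i - 1), by linear_combination hdet i⟩
  · intro i hi j hj hij
    rw [Prod.mk.injEq] at hij
    obtain ⟨e1, e2⟩ := hij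
    -- `p_i` is determined by `p_i q_{i-1} ≡ 1` modulo `q_i`
    have h1 := hdet i
    have h2 := hdet j
    rw [← e1, ← e2] at h2
    have hdvd : q Q i ∣ (p Q i - p Q j) * q Q (i - 1) :=
      ⟨p Q (i - 1) - p Q (j - 1), by linear_combination h1 - h2⟩
    have hc : IsCoprime (q Q i) (q Q (i - 1)) :=
      ⟨-p Q (i - 1), p Q i, by linear_combination h1⟩
    have hd := hc.dvd_of_dvd_mul_right hdvd
    have b1 := hp i hi
    have b2 := hp j hj
    rw [← e2] at b2
    have hz : p Q i - p Q j = 0 := by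
      refine Int.eq_zero_of_abs_lt_dvd hd (abs_lt.2 ⟨by linarith, by linarith⟩)
    refine (gam_strictMono hQ).injective ?_
    rw [gam_eq_div, gam_eq_div, ← e2, sub_eq_zero.1 hz]
  · rintro ⟨a, b⟩ hab
    simp only [pairs, Finset.mem_filter, Finset.mem_product, Finset.mem_Icc] at hab
    obtain ⟨⟨⟨ha1, ha2⟩, hb1, hb2⟩, hg, hlt⟩ := hab
    -- `c / b` with `c a ≡ 1` modulo `b` and `0 < c ≤ b`
    obtain ⟨u, c, huc, hc1, hc2⟩ :=
      exists_det_one (a := -a) (b := b) (Int.isCoprime_iff_gcd_eq_one.2 (by simpa using hg))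
        (by omega) b
    have hcop : Nat.Coprime c.natAbs b.natAbs := by
      rw [← Int.isCoprime_iff_nat_coprime]
      exact ⟨a, u, by linear_combination huc⟩
    have hden := Rat.den_div_eq_of_coprime (a := c) (b := b) (by omega) hcop
    have hnum := Rat.num_div_eq_of_coprime (a := c) (b := b) (by omega) hcop
    have hb0 : (0 : ℚ) < b := by exact_mod_cast (by omega : 0 < b)
    have hc0 : (0 : ℚ) < c := by exact_mod_cast (by omega : 0 < c)
    have hmem : (c : ℚ) / b ∈ farey Q :=
      mem_farey.2 ⟨by positivity, (div_le_one hb0).2 (by exact_mod_cast hc2), by omega⟩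
    obtain ⟨s, hs, h⟩ := List.getElem_of_mem ((Finset.mem_sort (· ≤ ·)).2 hmem)
    have hgam : gam Q (s + 1) = (c : ℚ) / b := by
      have := gam_eq 0 hs
      simp only [mul_zero, zero_add, Int.cast_zero, add_zero] at this
      exact this.trans h
    have hs' : s < N Q := by rw [← length_fareyList]; exact hs
    have e1 : p Q (s + 1) = c := by rw [p, hgam, hnum]
    have e2 : q Q (s + 1) = b := by rw [q, hgam, hden]
    refine ⟨s + 1, Finset.mem_Icc.2 ⟨by omega, by omega⟩, ?_⟩
    have h1 := hdet (s + 1)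
    have h2 := (consecutive hQ ((s + 1 : ℤ) - 1)).2
    have h3 := q_le hQ ((s + 1 : ℤ) - 1)
    rw [sub_add_cancel] at h2
    rw [e1, e2] at h1
    rw [e2] at h2 ⊢
    have hdvd : b ∣ c * (q Q ((s + 1 : ℤ) - 1) - a) :=
      ⟨p Q ((s + 1 : ℤ) - 1) + u, by linear_combination h1 - huc⟩
    have hc : IsCoprime b c := ⟨u, a, by linear_combination huc⟩
    have hz : q Q ((s + 1 : ℤ) - 1) - a = 0 :=
      Int.eq_zero_of_abs_lt_dvd (hc.dvd_of_dvd_mul_left hdvd)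
        (abs_lt.2 ⟨by linarith, by linarith⟩)
    rw [sub_eq_zero.1 hz]
  · intro i _
    rfl

/-- `T` permutes the scaled pairs of consecutive denominators. -/
lemma cnt_comp_T {Q : ℕ} (hQ : 1 ≤ Q) (f : ℝ × ℝ → ℝ) : cnt Q (fun z => f (T z)) = cnt Q f := by
  have hN := N_pos hQ
  rw [← sum_point hQ, ← sum_point hQ]
  simp only [T_point hQ]
  have hper : f (point Q (1 + N Q)) = f (point Q 1) := by
    rw [point, point, q_add_N hQ, add_sub_right_comm, q_add_N hQ]
  have hshift : ∑ i ∈ Finset.Icc (1 : ℤ) (N Q), f (point Q (i + 1)) =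
      ∑ i ∈ Finset.Icc (2 : ℤ) (N Q + 1), f (point Q i) := by
    refine Finset.sum_bij' (fun i _ => i + 1) (fun i _ => i - 1) ?_ ?_ ?_ ?_ ?_ <;>
      simp +contextual <;> omega
  have e1 : Finset.Icc (1 : ℤ) (N Q) = insert 1 (Finset.Icc 2 (N Q : ℤ)) := by
    ext; simp; omega
  have e2 : Finset.Icc (2 : ℤ) (N Q + 1) = insert (1 + N Q : ℤ) (Finset.Icc 2 (N Q : ℤ)) := by
    ext; simp; omega
  rw [hshift, e1, e2, Finset.sum_insert (by simp), Finset.sum_insert (by simp), hper]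

lemma cnt_comp_iterate_T {Q : ℕ} (hQ : 1 ≤ Q) (f : ℝ × ℝ → ℝ) (n : ℕ) :
    cnt Q (fun z => f (T^[n] z)) = cnt Q f := by
  induction n with
  | zero => rfl
  | succ n ih => exact (cnt_comp_T hQ fun z => f (T^[n] z)).trans ih

lemma cnt_one {Q : ℕ} (hQ : 1 ≤ Q) : cnt Q 1 = N Q := by
  rw [← sum_point hQ]
  simp

/-! ### The `k`-index as a signed continuant -/

lemma nu_zero (Q : ℕ) (i : ℤ) : nu Q 0 i = 0 := by
  simp [nu]

lemma nu_one {Q : ℕ} (hQ : 1 ≤ Q) (i : ℤ) : nu Q 1 i = 1 := by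
  have h := (consecutive hQ (i - 1)).1
  rw [sub_add_cancel] at h
  rw [nu, Nat.cast_one, add_sub_cancel_right]
  exact h

lemma nu_add_two {Q : ℕ} (hQ : 1 ≤ Q) (k : ℕ) (i : ℤ) :
    nu Q (k + 2) i = idx (point Q (i + k)) * nu Q (k + 1) i - nu Q k i := by
  obtain ⟨h1, h2⟩ := q_add_q hQ (i + k)
  have e1 : i + ((k + 2 : ℕ) : ℤ) - 1 = i + k + 1 := by push_cast; ring
  have e2 : i + ((k + 1 : ℕ) : ℤ) - 1 = i + k := by push_cast; ring
  rw [nu, nu, nu, e1, e2]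
  linear_combination q Q (i - 1) * h2 - p Q (i - 1) * h1

/-- Recurrences for the Kronecker symbol `((2n - 1) / 2) = (-1) ^ (n (n - 1) / 2)`. -/
lemma chi_recurrence (n : ℕ) :
    ZMod.χ₈ ((2 * ((n + 1 : ℕ) : ℤ) - 1 : ℤ) : ZMod 8) =
      (-1) ^ n * ZMod.χ₈ ((2 * (n : ℤ) - 1 : ℤ) : ZMod 8) ∧
    ZMod.χ₈ ((2 * ((n + 2 : ℕ) : ℤ) - 1 : ℤ) : ZMod 8) =
      -ZMod.χ₈ ((2 * (n : ℤ) - 1 : ℤ) : ZMod 8) := by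
  obtain ⟨t, r, hr, rfl⟩ : ∃ t r : ℕ, r < 4 ∧ n = 4 * t + r :=
    ⟨n / 4, n % 4, Nat.mod_lt _ (by norm_num), (Nat.div_add_mod n 4).symm⟩
  have h8 : (8 : ZMod 8) = 0 := rfl
  have hcast : ∀ s : ℕ, ((2 * ((4 * t + s : ℕ) : ℤ) - 1 : ℤ) : ZMod 8) = 2 * (s : ZMod 8) - 1 := by
    intro s
    push_cast
    linear_combination (t : ZMod 8) * h8
  rw [add_assoc, add_assoc, hcast, hcast, hcast, pow_add, pow_mul]
  interval_cases r <;> simp <;> decide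

lemma nu_eq_eval {Q : ℕ} (hQ : 1 ≤ Q) (i : ℤ) (n : ℕ) :
    nu Q (n + 1) i = ZMod.χ₈ ((2 * ((n + 1 : ℕ) : ℤ) - 1 : ℤ) : ZMod 8) *
      MvPolynomial.eval (fun j : ℕ => (-1) ^ j * (idx (point Q (i + j - 1)) : ℤ)) (K n) := by
  induction n using Nat.twoStepInduction with
  | zero =>
    rw [nu_one hQ, K, map_one]
    decide
  | one =>
    rw [nu_add_two hQ, nu_zero, nu_one hQ, K, MvPolynomial.eval_X]
    have : ZMod.χ₈ ((2 * ((1 + 1 : ℕ) : ℤ) - 1 : ℤ) : ZMod 8) = -1 := by decide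
    rw [this]
    simp
  | more n ih1 ih2 =>
    have e : i + ((n + 2 : ℕ) : ℤ) - 1 = i + ((n + 1 : ℕ) : ℤ) := by push_cast; ring
    have h1 := (chi_recurrence (n + 2)).1
    have h2 := (chi_recurrence (n + 1)).2
    have hs : ((-1 : ℤ) ^ (n + 2)) * (-1) ^ (n + 2) = 1 := by
      rw [← mul_pow]; simp
    rw [nu_add_two hQ, ih1, ih2, K, map_add, map_mul, MvPolynomial.eval_X, mul_add]
    simp only [e]
    rw [show n + 2 + 1 = n + 1 + 2 from rfl] at h1 ⊢
    rw [sub_eq_add_neg, ← neg_mul, ← h2, h1]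
    rw [show n + 1 + 1 = n + 2 from rfl]
    linear_combination (-(ZMod.χ₈ ((2 * ((n + 2 : ℕ) : ℤ) - 1 : ℤ) : ZMod 8) *
      MvPolynomial.eval (fun j : ℕ => (-1) ^ j * (idx (point Q (i + j - 1)) : ℤ)) (K (n + 1)) *
        (idx (point Q (i + ((n + 1 : ℕ) : ℤ))) : ℤ))) * hs

/-- The polynomial `K n` is a sum of distinct square-free monomials in `x_1, …, x_n`. -/
lemma K_support (n : ℕ) : ∀ m ∈ (K n).support,
    MvPolynomial.coeff m (K n) = 1 ∧ (∀ j, m j ≤ 1) ∧ ∀ j ∈ m.support, 1 ≤ j ∧ j ≤ n := by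
  induction n using Nat.twoStepInduction with
  | zero =>
    intro m hm
    rw [MvPolynomial.mem_support_iff, K, MvPolynomial.coeff_one] at hm
    have : m = 0 := by by_contra h; exact hm (if_neg (Ne.symm h))
    subst this
    simp [K]
  | one =>
    intro m hm
    rw [MvPolynomial.mem_support_iff, K, MvPolynomial.coeff_X] at hm
    have : Finsupp.single 1 1 = m := by by_contra h; exact hm (if_neg h)
    subst this
    refine ⟨by simp [K], fun j => ?_, fun j hj => ?_⟩
    · rw [Finsupp.single_apply]; split_ifs <;> simp
    · have := Finsupp.support_single_subset hj
      simp at this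
      omega
  | more n ih1 ih2 =>
    intro m hm
    rw [MvPolynomial.mem_support_iff, K, MvPolynomial.coeff_add, MvPolynomial.coeff_X_mul'] at hm
    rw [K, MvPolynomial.coeff_add, MvPolynomial.coeff_X_mul']
    by_cases hmem : n + 2 ∈ m.support
    · have h0 : MvPolynomial.coeff m (K n) = 0 := by
        by_contra h
        have := ((ih1 m (MvPolynomial.mem_support_iff.2 h)).2.2 _ hmem).2
        omega
      rw [if_pos hmem, h0, add_zero] at hm ⊢
      obtain ⟨h1, h2, h3⟩ := ih2 _ (MvPolynomial.mem_support_iff.2 hm)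
      have hne : ∀ j, j ≠ n + 2 → (m - Finsupp.single (n + 2) 1 : ℕ →₀ ℕ) j = m j := by
        intro j hj
        simp [hj]
      refine ⟨h1, fun j => ?_, fun j hj => ?_⟩
      · by_cases hj : j = n + 2
        · subst hj
          by_contra! hlt
          have : n + 2 ∈ (m - Finsupp.single (n + 2) 1).support := by
            rw [Finsupp.mem_support_iff, Finsupp.tsub_apply, Finsupp.single_eq_same]
            omega
          have := (h3 _ this).2
          omega
        · rw [← hne j hj]
          exact h2 j
      · by_cases hj' : j = n + 2
        · omega
        · have : j ∈ (m - Finsupp.single (n + 2) 1).support := by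
            rw [Finsupp.mem_support_iff, hne j hj']
            exact Finsupp.mem_support_iff.1 hj
          have := h3 _ this
          omega
    · rw [if_neg hmem, zero_add] at hm ⊢
      obtain ⟨h1, h2, h3⟩ := ih1 _ (MvPolynomial.mem_support_iff.2 hm)
      exact ⟨h1, h2, fun j hj => by have := h3 j hj; omega⟩

/-- The product of the indices at the times `j - 1`, `j ∈ J`, along the orbit of `z`. -/
def idxProd (J : Finset ℕ) (z : ℝ × ℝ) : ℝ := ∏ j ∈ J, (idx (T^[j - 1] z) : ℝ)

lemma nu_eq_sum {Q : ℕ} (hQ : 1 ≤ Q) (i : ℤ) (n : ℕ) :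
    (nu Q (n + 1) i : ℝ) = ∑ m ∈ (K n).support,
      (sign (n + 1) m.support : ℝ) * idxProd m.support (point Q i) := by
  rw [nu_eq_eval hQ, MvPolynomial.eval_eq, Finset.mul_sum, Int.cast_sum]
  refine Finset.sum_congr rfl fun m hm => ?_
  obtain ⟨h1, h2, h3⟩ := K_support n m hm
  have hprod : ∏ j ∈ m.support, ((-1) ^ j * (idx (point Q (i + j - 1)) : ℤ)) ^ m j =
      (∏ j ∈ m.support, (-1) ^ j) * ∏ j ∈ m.support, (idx (T^[j - 1] (point Q i)) : ℤ) := by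
    rw [← Finset.prod_mul_distrib]
    refine Finset.prod_congr rfl fun j hj => ?_
    have hj1 := (h3 j hj).1
    have : m j = 1 := by
      have := h2 j
      have := Finsupp.mem_support_iff.1 hj
      omega
    rw [this, pow_one, iterate_T_point hQ, Nat.cast_sub hj1, Nat.cast_one, add_sub_assoc]
  rw [h1, one_mul, hprod, sign, idxProd]
  push_cast
  ring

/-! ### Integrals over the Farey triangle -/

/-- Area measure on the Farey triangle. -/
def triMeasure : Measure (ℝ × ℝ) := volume.restrict triangle

lemma volume_triangle_lt_top : volume triangle < ⊤ := by
  refine (measure_mono (t := Set.Icc (0 : ℝ) 1 ×ˢ Set.Icc (0 : ℝ) 1) fun z hz => ?_).trans_lt ?_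
  · exact ⟨hz.1, hz.2.1⟩
  · rw [Measure.volume_eq_prod, Measure.prod_prod]
    simp

instance : IsFiniteMeasure triMeasure :=
  ⟨by rw [triMeasure, Measure.restrict_apply_univ]; exact volume_triangle_lt_top⟩

lemma ae_mem_triangle : ∀ᵐ z ∂triMeasure, z ∈ triangle :=
  ae_restrict_mem measurableSet_triangle

lemma measurable_idx : Measurable idx := by
  unfold idx
  exact Nat.measurable_floor.comp (by fun_prop)

lemma measurable_T : Measurable T := by
  unfold T
  have : Measurable fun z : ℝ × ℝ => ⌊(1 + z.1) / z.2⌋ := Int.measurable_floor.comp (by fun_prop)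
  have h : Measurable fun z : ℝ × ℝ => ((⌊(1 + z.1) / z.2⌋ : ℤ) : ℝ) :=
    (measurable_from_top (f := fun n : ℤ => (n : ℝ))).comp this
  exact measurable_snd.prodMk ((h.mul measurable_snd).sub measurable_fst)

lemma measurable_reflect : Measurable reflect := by
  unfold reflect
  have h : Measurable fun z : ℝ × ℝ => ((idx z : ℕ) : ℝ) :=
    (measurable_from_top (f := fun n : ℕ => (n : ℝ))).comp measurable_idx
  exact ((h.mul measurable_snd).sub measurable_fst).prodMk measurable_snd

lemma measurePreserving_linear_reflection (c : ℝ) :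
    MeasurePreserving (fun z : ℝ × ℝ => (c * z.2 - z.1, z.2)) volume volume := by
  have hswap : MeasurePreserving (Prod.swap : ℝ × ℝ → ℝ × ℝ) volume volume :=
    Measure.measurePreserving_swap
  have hskew : MeasurePreserving (fun z : ℝ × ℝ => (z.1, c * z.1 - z.2)) volume volume :=
    (MeasurePreserving.id volume).skew_product (g := fun y x : ℝ => c * y - x)
      (by fun_prop) (Eventually.of_forall fun y =>
        (Measure.measurePreserving_sub_left volume (c * y)).map_eq)
  exact (hswap.comp hskew).comp hswap

lemma volume_inter_triangle {E : Set (ℝ × ℝ)} (hE : MeasurableSet E) :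
    volume (E ∩ triangle) = ∑' l : ℕ, volume (E ∩ region l) := by
  have h : E ∩ triangle = ⋃ l : ℕ, E ∩ region l := by
    ext z
    simp [region_eq]
  rw [h, measure_iUnion]
  · intro l l' hne
    refine Set.disjoint_left.2 fun z hz hz' => hne ?_
    simp only [region_eq] at hz hz'
    exact hz.2.2.symm.trans hz'.2.2
  · exact fun l => hE.inter (polygonal_region l).measurableSet

lemma volume_preimage_reflect {E : Set (ℝ × ℝ)} (hE : MeasurableSet E) :
    volume (reflect ⁻¹' E ∩ triangle) = volume (E ∩ triangle) := by
  rw [volume_inter_triangle hE, volume_inter_triangle (measurable_reflect hE)]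
  refine tsum_congr fun l => ?_
  rw [← (measurePreserving_linear_reflection l).measure_preimage
    (hE.inter (polygonal_region l).measurableSet).nullMeasurableSet]
  congr 1
  ext z
  simp only [region_eq, Set.mem_inter_iff, Set.mem_preimage, Set.mem_ofPred_eq]
  constructor
  · rintro ⟨hzE, hz, rfl⟩
    exact ⟨hzE, reflect_mem hz, idx_reflect hz⟩
  · rintro ⟨hzE, hz, hl⟩
    have hr : reflect ((l : ℝ) * z.2 - z.1, z.2) = z := by
      rw [reflect, hl]
      simp
    have h1 := reflect_mem hz
    have h2 := idx_reflect hz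
    have h3 := reflect_reflect hz
    rw [hr] at h1 h2 h3
    rw [h3]
    exact ⟨hzE, h1, h2.trans hl⟩

/-- `T` preserves area on the Farey triangle: on each region it is a reflection of the region
onto itself followed by the coordinate swap. -/
lemma measurePreserving_T : MeasurePreserving T triMeasure triMeasure := by
  refine ⟨measurable_T, Measure.ext fun E hE => ?_⟩
  rw [Measure.map_apply measurable_T hE, triMeasure, Measure.restrict_apply (measurable_T hE),
    Measure.restrict_apply hE]
  have h1 : T ⁻¹' E ∩ triangle = reflect ⁻¹' (Prod.swap ⁻¹' E) ∩ triangle := by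
    ext z
    refine and_congr_left fun hz => ?_
    rw [Set.mem_preimage, Set.mem_preimage, Set.mem_preimage, T_eq hz]
  have h2 : Prod.swap ⁻¹' E ∩ triangle = Prod.swap ⁻¹' (E ∩ triangle) := by
    ext z
    simp [swap_mem_triangle]
  have hswap : MeasurePreserving (Prod.swap : ℝ × ℝ → ℝ × ℝ) volume volume :=
    Measure.measurePreserving_swap
  rw [h1, volume_preimage_reflect (measurable_swap hE), h2,
    hswap.measure_preimage (hE.inter measurableSet_triangle).nullMeasurableSet]

lemma measurable_idx_iterate (n : ℕ) : Measurable fun z => (idx (T^[n] z) : ℝ) :=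
  (measurable_from_top (f := fun n : ℕ => (n : ℝ))).comp
    (measurable_idx.comp (measurable_T.iterate n))

lemma measurable_idxProd (J : Finset ℕ) : Measurable (idxProd J) :=
  Finset.measurable_prod _ fun j _ => measurable_idx_iterate (j - 1)

lemma idxProd_nonneg (J : Finset ℕ) (z : ℝ × ℝ) : 0 ≤ idxProd J z :=
  Finset.prod_nonneg fun _ _ => Nat.cast_nonneg _

/-- The set whose area is `interArea J l`. -/
def interSet (J : Finset ℕ) (l : J → ℕ+) : Set (ℝ × ℝ) :=
  triangle ∩ ⋂ j : J, (T^[(j : ℕ) - 1]) ⁻¹' regionStar (l j)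

lemma measurableSet_interSet (J : Finset ℕ) (l : J → ℕ+) : MeasurableSet (interSet J l) :=
  measurableSet_triangle.inter (MeasurableSet.iInter fun j =>
    measurable_T.iterate _ (polygonal_regionStar (l j)).measurableSet)

lemma tsum_indicator_interSet (J : Finset ℕ) {z : ℝ × ℝ} (hz : z ∈ triangle) :
    ∑' l : J → ℕ+, (interSet J l).indicator (1 : ℝ × ℝ → ENNReal) z =
      ENNReal.ofReal (idxProd J z) := by
  classical
  let a : J → ℕ+ := fun j =>
    ⟨idx (T^[(j : ℕ) - 1] z), one_le_idx (iterate_T_mem hz _)⟩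
  have hmem : ∀ l : J → ℕ+, z ∈ interSet J l ↔
      l ∈ Fintype.piFinset fun j => Finset.Icc (1 : ℕ+) (a j) := by
    intro l
    rw [Fintype.mem_piFinset]
    simp only [interSet, Set.mem_inter_iff, hz, true_and, Set.mem_iInter, Set.mem_preimage,
      mem_regionStar, iterate_T_mem hz]
    refine forall_congr' fun j => ?_
    rw [Finset.mem_Icc, ← PNat.coe_le_coe (l j)]
    exact (and_iff_right one_le).symm
  rw [tsum_eq_sum (s := Fintype.piFinset fun j => Finset.Icc (1 : ℕ+) (a j))]
  · rw [Finset.sum_congr rfl fun l hl => Set.indicator_of_mem ((hmem l).2 hl) _]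
    simp only [Pi.one_apply, Finset.sum_const, Fintype.card_piFinset, PNat.card_Icc,
      nsmul_eq_mul, mul_one]
    rw [idxProd, ← Finset.prod_coe_sort J fun j => (idx (T^[j - 1] z) : ℝ), ← Nat.cast_prod,
      ENNReal.ofReal_natCast]
    congr 1
  · intro l hl
    exact Set.indicator_of_notMem (fun h => hl ((hmem l).1 h)) _

lemma lintegral_idxProd (J : Finset ℕ) :
    ∫⁻ z, ENNReal.ofReal (idxProd J z) ∂triMeasure = ∑' l : J → ℕ+, volume (interSet J l) := by
  have h : ∀ l : J → ℕ+, volume (interSet J l) =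
      ∫⁻ z, (interSet J l).indicator (1 : ℝ × ℝ → ENNReal) z ∂triMeasure := by
    intro l
    rw [lintegral_indicator_one (measurableSet_interSet J l), triMeasure,
      Measure.restrict_apply (measurableSet_interSet J l),
      Set.inter_eq_left.2 (show interSet J l ⊆ triangle from Set.inter_subset_left)]
  simp_rw [h]
  rw [← lintegral_tsum fun l =>
    (measurable_one.indicator (measurableSet_interSet J l)).aemeasurable]
  refine lintegral_congr_ae ?_
  filter_upwards [ae_mem_triangle] with z hz
  exact (tsum_indicator_interSet J hz).symm

/-- Summing the areas over all tuples `l` integrates the product of the indices. -/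
lemma hasSum_interArea {J : Finset ℕ} (hint : Integrable (idxProd J) triMeasure) :
    HasSum (interArea J) (∫ z, idxProd J z ∂triMeasure) := by
  have hfin : ∑' l : J → ℕ+, volume (interSet J l) ≠ ⊤ := by
    rw [← lintegral_idxProd]
    exact (hint.lintegral_lt_top).ne
  have h : ∫ z, idxProd J z ∂triMeasure = ∑' l : J → ℕ+, interArea J l := by
    rw [integral_eq_lintegral_of_nonneg_ae (Eventually.of_forall (idxProd_nonneg J))
      (measurable_idxProd J).aestronglyMeasurable, lintegral_idxProd,
      ENNReal.tsum_toReal_eq fun l => ENNReal.ne_top_of_tsum_ne_top hfin l]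
    rfl
  rw [h]
  exact (ENNReal.summable_toReal hfin).hasSum

lemma regionStar_subset_box {l : ℕ} (hl : 1 ≤ l) {z : ℝ × ℝ} (hz : z ∈ regionStar l) :
    (1 - 2 / (l : ℝ) ≤ z.1 ∧ z.1 ≤ 1) ∧ 0 < z.2 ∧ z.2 ≤ 2 / (l : ℝ) := by
  have hl0 : (0 : ℝ) < l := by exact_mod_cast hl
  obtain ⟨hz, h⟩ := mem_regionStar.1 hz
  rw [le_idx_iff hz] at h
  obtain ⟨⟨h1, h2⟩, ⟨h3, h4⟩, h5⟩ := mem_triangle.1 hz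
  have h6 : z.2 ≤ 2 / (l : ℝ) := by
    rw [le_div_iff₀ hl0]
    linarith
  exact ⟨⟨by linarith, h2⟩, h3, h6⟩

lemma volume_regionStar_le {l : ℕ} (hl : 1 ≤ l) :
    volume (regionStar l) ≤ ENNReal.ofReal (4 / (l : ℝ) ^ 2) := by
  have hl0 : (0 : ℝ) < l := by exact_mod_cast hl
  refine (measure_mono (t := Set.Icc (1 - 2 / (l : ℝ)) 1 ×ˢ Set.Icc 0 (2 / (l : ℝ)))
    fun z hz => ?_).trans ?_
  · obtain ⟨h1, h2, h3⟩ := regionStar_subset_box hl hz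
    exact ⟨h1, h2.le, h3⟩
  · rw [Measure.volume_eq_prod, Measure.prod_prod, Real.volume_Icc, Real.volume_Icc,
      ← ENNReal.ofReal_mul (by rw [sub_sub_cancel]; positivity)]
    refine ENNReal.ofReal_le_ofReal (le_of_eq ?_)
    field_simp
    ring

lemma area_regionStar_le {l : ℕ} (hl : 1 ≤ l) : volume.real (regionStar l) ≤ 4 / (l : ℝ) ^ 2 :=
  ENNReal.toReal_le_of_le_ofReal (by positivity) (volume_regionStar_le hl)

lemma tsum_indicator_regionStar {z : ℝ × ℝ} (hz : z ∈ triangle) :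
    ∑' l : ℕ, (regionStar (l + 1)).indicator (1 : ℝ × ℝ → ENNReal) z =
      ENNReal.ofReal (idx z) := by
  rw [tsum_eq_sum (s := Finset.range (idx z))]
  · rw [Finset.sum_congr rfl fun l hl => Set.indicator_of_mem
      (mem_regionStar.2 ⟨hz, Finset.mem_range.1 hl⟩) _]
    simp
  · intro l hl
    refine Set.indicator_of_notMem (fun h => hl ?_) _
    exact Finset.mem_range.2 (mem_regionStar.1 h).2

lemma lintegral_idx :
    ∫⁻ z, ENNReal.ofReal (idx z) ∂triMeasure = ∑' l : ℕ, volume (regionStar (l + 1)) := by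
  have hms : ∀ l, MeasurableSet (regionStar l) := fun l => (polygonal_regionStar l).measurableSet
  have h : ∀ l : ℕ, volume (regionStar (l + 1)) =
      ∫⁻ z, (regionStar (l + 1)).indicator (1 : ℝ × ℝ → ENNReal) z ∂triMeasure := by
    intro l
    rw [lintegral_indicator_one (hms _), triMeasure, Measure.restrict_apply (hms _),
      Set.inter_eq_left.2 fun z hz => (mem_regionStar.1 hz).1]
  simp_rw [h]
  rw [← lintegral_tsum fun l => (measurable_one.indicator (hms _)).aemeasurable]
  refine lintegral_congr_ae ?_
  filter_upwards [ae_mem_triangle] with z hz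
  exact (tsum_indicator_regionStar hz).symm

lemma tsum_volume_regionStar_ne_top : ∑' l : ℕ, volume (regionStar (l + 1)) ≠ ⊤ := by
  have hs : Summable fun l : ℕ => 4 / ((l + 1 : ℕ) : ℝ) ^ 2 := by
    have := (summable_nat_add_iff 1).2 (Real.summable_nat_pow_inv.2 (by norm_num : 1 < 2))
    simpa [div_eq_mul_inv] using this.mul_left 4
  refine ne_top_of_le_ne_top ?_ (ENNReal.tsum_le_tsum fun l =>
    volume_regionStar_le (Nat.succ_pos l))
  rw [← ENNReal.ofReal_tsum_of_nonneg (fun l => by positivity) hs]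
  exact ENNReal.ofReal_ne_top

lemma integrable_idx : Integrable (fun z => (idx z : ℝ)) triMeasure := by
  refine ⟨(measurable_idx_iterate 0).aestronglyMeasurable, ?_⟩
  rw [hasFiniteIntegral_iff_ofReal (Eventually.of_forall fun z => Nat.cast_nonneg _),
    lintegral_idx]
  exact tsum_volume_regionStar_ne_top.lt_top

lemma hasSum_area_regionStar :
    HasSum (fun l : ℕ => volume.real (regionStar (l + 1))) (∫ z, (idx z : ℝ) ∂triMeasure) := by
  have h : ∫ z, (idx z : ℝ) ∂triMeasure = ∑' l : ℕ, volume.real (regionStar (l + 1)) := by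
    rw [integral_eq_lintegral_of_nonneg_ae (Eventually.of_forall fun z => Nat.cast_nonneg _)
      integrable_idx.aestronglyMeasurable, lintegral_idx, ENNReal.tsum_toReal_eq
      fun l => ENNReal.ne_top_of_tsum_ne_top tsum_volume_regionStar_ne_top l]
    rfl
  rw [h]
  exact (ENNReal.summable_toReal tsum_volume_regionStar_ne_top).hasSum

/-! ### Equidistribution -/

/-- The sum of `f` over the scaled pairs of consecutive denominators is asymptotic to
`density * Q² * ∫ f`, with an error `O(Q (log Q)²)`. -/
def Equidistributes (f : ℝ × ℝ → ℝ) : Prop :=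
  Integrable f triMeasure ∧ ∃ C : ℝ, ∀ Q : ℕ, 3 ≤ Q →
    |cnt Q f - density * Q ^ 2 * ∫ z, f z ∂triMeasure| ≤ C * (Q * Real.log Q ^ 2)

lemma one_le_log {Q : ℕ} (hQ : 3 ≤ Q) : 1 ≤ Real.log Q := by
  have h3 : (3 : ℝ) ≤ Q := by exact_mod_cast hQ
  rw [Real.le_log_iff_exp_le (by linarith)]
  linarith [Real.exp_one_lt_d9]

lemma scaled_mem_triangle {Q : ℕ} {x : ℤ × ℤ} (hx : x ∈ pairs Q) : scaled Q x ∈ triangle := by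
  simp only [pairs, Finset.mem_filter, Finset.mem_product, Finset.mem_Icc] at hx
  obtain ⟨⟨⟨h1, h2⟩, h3, h4⟩, -, h5⟩ := hx
  have hQ : (0 : ℝ) < Q := by exact_mod_cast h1.trans h2
  rw [mem_triangle, scaled]
  simp only
  rw [← add_div, one_lt_div hQ, div_le_one hQ, div_le_one hQ]
  refine ⟨⟨div_pos ?_ hQ, ?_⟩, ⟨div_pos ?_ hQ, ?_⟩, ?_⟩
  · exact_mod_cast h1
  · exact_mod_cast h2
  · exact_mod_cast h3
  · exact_mod_cast h4
  · exact_mod_cast h5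

lemma Equidistributes.congr {f g : ℝ × ℝ → ℝ} (hf : Equidistributes f)
    (h : ∀ z ∈ triangle, f z = g z) : Equidistributes g := by
  have hae : f =ᵐ[triMeasure] g := by
    filter_upwards [ae_mem_triangle] with z hz using h z hz
  obtain ⟨hi, C, hC⟩ := hf
  refine ⟨hi.congr hae, C, fun Q hQ => ?_⟩
  rw [← integral_congr_ae hae]
  have : cnt Q g = cnt Q f :=
    Finset.sum_congr rfl fun x hx => (h _ (scaled_mem_triangle hx)).symm
  rw [this]
  exact hC Q hQ

lemma Equidistributes.add {f g : ℝ × ℝ → ℝ} (hf : Equidistributes f) (hg : Equidistributes g) :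
    Equidistributes fun z => f z + g z := by
  obtain ⟨hf, C, hC⟩ := hf
  obtain ⟨hg, D, hD⟩ := hg
  refine ⟨hf.add hg, C + D, fun Q hQ => ?_⟩
  have e : cnt Q (fun z => f z + g z) = cnt Q f + cnt Q g := Finset.sum_add_distrib
  rw [integral_add hf hg, e, mul_add, add_mul, add_sub_add_comm]
  exact (abs_add_le _ _).trans (add_le_add (hC Q hQ) (hD Q hQ))

lemma Equidistributes.const_mul {f : ℝ × ℝ → ℝ} (hf : Equidistributes f) (c : ℝ) :
    Equidistributes fun z => c * f z := by
  obtain ⟨hf, C, hC⟩ := hf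
  refine ⟨hf.const_mul c, |c| * C, fun Q hQ => ?_⟩
  have e : cnt Q (fun z => c * f z) = c * cnt Q f := (Finset.mul_sum _ _ _).symm
  rw [integral_const_mul, e, mul_left_comm, ← mul_sub, abs_mul, mul_assoc |c|]
  exact mul_le_mul_of_nonneg_left (hC Q hQ) (abs_nonneg c)

lemma equidistributes_zero : Equidistributes fun _ => 0 :=
  ⟨integrable_zero _ _ _, 0, fun Q _ => by simp [cnt]⟩

lemma equidistributes_sum {ι : Type*} (s : Finset ι) (f : ι → ℝ × ℝ → ℝ)
    (h : ∀ i ∈ s, Equidistributes (f i)) : Equidistributes fun z => ∑ i ∈ s, f i z := by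
  classical
  induction s using Finset.induction_on with
  | empty => simpa using equidistributes_zero
  | insert a s ha ih =>
    simp only [Finset.sum_insert ha]
    exact (h a (Finset.mem_insert_self _ _)).add
      (ih fun i hi => h i (Finset.mem_insert_of_mem hi))

lemma Equidistributes.comp_iterate_T {f : ℝ × ℝ → ℝ} (hf : Equidistributes f) (n : ℕ) :
    Equidistributes fun z => f (T^[n] z) := by
  obtain ⟨hf, C, hC⟩ := hf
  have hT := measurePreserving_T.iterate n
  have hint : ∫ z, f (T^[n] z) ∂triMeasure = ∫ z, f z ∂triMeasure := by
    conv_rhs => rw [← hT.map_eq]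
    rw [integral_map hT.measurable.aemeasurable (by rw [hT.map_eq]; exact hf.1)]
  refine ⟨hT.integrable_comp_of_integrable hf, C, fun Q hQ => ?_⟩
  rw [hint, cnt_comp_iterate_T (by omega)]
  exact hC Q hQ

lemma integral_indicator_one_triMeasure {S : Set (ℝ × ℝ)} (hS : S ⊆ triangle)
    (hm : MeasurableSet S) : ∫ z, S.indicator (1 : ℝ × ℝ → ℝ) z ∂triMeasure = volume.real S := by
  rw [integral_indicator_one hm, triMeasure, measureReal_restrict_apply hm,
    Set.inter_eq_left.2 hS]

open Classical in
lemma lattice_eq_card {S : Set (ℝ × ℝ)} {R : ℝ} (hR : 0 < R) {I J : Finset ℤ}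
    (hIJ : ∀ z ∈ S, ⌈R * z.1⌉ ∈ I ∧ ⌈R * z.2⌉ ∈ J) :
    lattice R S = ((I ×ˢ J).filter fun x => scaled R x ∈ S).card := by
  rw [lattice, ← Set.ncard_coe_finset]
  congr 1
  ext x
  simp only [Set.mem_ofPred_eq, Finset.coe_filter, Finset.mem_product]
  refine ⟨fun hx => ⟨?_, hx⟩, fun hx => hx.2⟩
  have h := hIJ _ hx
  simpa [scaled, mul_div_cancel₀ _ hR.ne'] using h

lemma abs_lattice_sub_le {k : ℕ} {S : Set (ℝ × ℝ)} (h : Polygonal k S) (hS : S ⊆ triangle)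
    {R : ℝ} (hR : 1 ≤ R) :
    |(lattice R S : ℝ) - R ^ 2 * volume.real S| ≤ 20 * k * R := by
  have hR0 : 0 < R := by linarith
  have hbox : ∀ z ∈ S, ⌈R * z.1⌉ ∈ Finset.Icc 1 ⌈R⌉ ∧ ⌈R * z.2⌉ ∈ Finset.Icc 1 ⌈R⌉ := by
    intro z hz
    obtain ⟨⟨h1, h2⟩, ⟨h3, h4⟩, -⟩ := mem_triangle.1 (hS hz)
    rw [Finset.mem_Icc, Finset.mem_Icc]
    exact ⟨⟨Int.one_le_ceil_iff.2 (by positivity), Int.ceil_mono (by nlinarith)⟩,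
      Int.one_le_ceil_iff.2 (by positivity), Int.ceil_mono (by nlinarith)⟩
  have hcard : (((Finset.Icc 1 ⌈R⌉).card : ℕ) : ℝ) ≤ 2 * R := by
    rw [Int.card_Icc, add_sub_cancel_right]
    have h1 : ((⌈R⌉.toNat : ℕ) : ℝ) = (⌈R⌉ : ℝ) := by
      have := Int.toNat_of_nonneg (Int.ceil_nonneg hR0.le)
      exact_mod_cast this
    rw [h1]
    linarith [Int.ceil_lt_add_one R]
  rw [lattice_eq_card hR0 hbox]
  refine (abs_card_sub_area_le h hR0 _ _ hbox).trans ?_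
  have hk : (0 : ℝ) ≤ k := Nat.cast_nonneg k
  nlinarith

lemma equidistributes_indicator {k : ℕ} {S : Set (ℝ × ℝ)} (h : Polygonal k S)
    (hS : S ⊆ triangle) : Equidistributes (S.indicator 1) := by
  refine ⟨(integrable_const (1 : ℝ)).indicator h.measurableSet,
    40 * k + 2 * volume.real S, fun Q hQ => ?_⟩
  have hL := one_le_log hQ
  rw [integral_indicator_one_triMeasure hS h.measurableSet]
  refine (abs_cnt_indicator_sub_le hS (fun R hR => abs_lattice_sub_le h hS hR)
    (by omega)).trans ?_
  have hV : 0 ≤ volume.real S := measureReal_nonneg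
  have hL2 : Real.log Q ≤ Real.log Q ^ 2 := by nlinarith
  have h1 : 20 * (k : ℝ) * Q * (1 + Real.log Q) ≤ 20 * (k : ℝ) * Q * (2 * Real.log Q ^ 2) := by
    gcongr
    linarith
  have h2 : 2 * (Q : ℝ) * volume.real S * 1 ≤ 2 * (Q : ℝ) * volume.real S * Real.log Q ^ 2 := by
    gcongr
    linarith
  linarith

/-- The lattice point count for the thin region `𝒯_l^*`, with an error inversely proportional
to `l`. -/
lemma abs_lattice_regionStar_sub_le {l : ℕ} (hl : 1 ≤ l) {R : ℝ} (hR : 1 ≤ R) :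
    |(lattice R (regionStar l) : ℝ) - R ^ 2 * volume.real (regionStar l)| ≤ 300 / l * R := by
  have hR0 : 0 < R := by linarith
  have hl0 : (0 : ℝ) < l := by exact_mod_cast hl
  rcases le_or_gt (1 / 2) (R / l) with h | h
  · have hbox : ∀ z ∈ regionStar l, ⌈R * z.1⌉ ∈ Finset.Icc ⌈R - 2 * (R / l)⌉ ⌈R⌉ ∧
        ⌈R * z.2⌉ ∈ Finset.Icc 1 ⌈2 * (R / l)⌉ := by
      intro z hz
      obtain ⟨⟨h1, h2⟩, h3, h4⟩ := regionStar_subset_box hl hz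
      rw [Finset.mem_Icc, Finset.mem_Icc]
      have e1 : R * (1 - 2 / (l : ℝ)) = R - 2 * (R / l) := by ring
      have e2 : R * (2 / (l : ℝ)) = 2 * (R / l) := by ring
      refine ⟨⟨Int.ceil_mono ?_, Int.ceil_mono (by nlinarith)⟩,
        Int.one_le_ceil_iff.2 (by positivity), Int.ceil_mono ?_⟩
      · rw [← e1]; gcongr
      · rw [← e2]; gcongr
    have c1 : (((Finset.Icc ⌈R - 2 * (R / l)⌉ ⌈R⌉).card : ℕ) : ℝ) ≤ 2 * (R / l) + 2 := by
      have hmono : ⌈R - 2 * (R / l)⌉ ≤ ⌈R⌉ := Int.ceil_mono (by linarith)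
      have h1 := Int.toNat_of_nonneg (show 0 ≤ ⌈R⌉ + 1 - ⌈R - 2 * (R / l)⌉ by omega)
      have h2 : (((⌈R⌉ + 1 - ⌈R - 2 * (R / l)⌉).toNat : ℕ) : ℝ) =
          ⌈R⌉ + 1 - ⌈R - 2 * (R / l)⌉ := by exact_mod_cast h1
      rw [Int.card_Icc, h2]
      linarith [Int.ceil_lt_add_one R, Int.le_ceil (R - 2 * (R / l))]
    have c2 : (((Finset.Icc 1 ⌈2 * (R / l)⌉).card : ℕ) : ℝ) ≤ 2 * (R / l) + 1 := by
      have h1 := Int.toNat_of_nonneg (Int.ceil_nonneg (show 0 ≤ 2 * (R / l) by positivity))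
      have h2 : ((⌈2 * (R / l)⌉.toNat : ℕ) : ℝ) = ⌈2 * (R / l)⌉ := by exact_mod_cast h1
      rw [Int.card_Icc, add_sub_cancel_right, h2]
      exact (Int.ceil_lt_add_one _).le
    rw [lattice_eq_card hR0 hbox]
    refine (abs_card_sub_area_le (polygonal_regionStar l) hR0 _ _ hbox).trans ?_
    have e : 300 / (l : ℝ) * R = 300 * (R / l) := by ring
    rw [e]
    push_cast
    linarith
  · -- here the dilated region lies below the height `1` and contains no lattice point
    have h0 : lattice R (regionStar l) = 0 := by
      rw [lattice]
      convert Set.ncard_empty (ℤ × ℤ)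
      refine Set.eq_empty_iff_forall_notMem.2 fun x hx => ?_
      obtain ⟨-, h3, h4⟩ := regionStar_subset_box hl hx
      simp only [scaled] at h3 h4
      rw [div_pos_iff_of_pos_right hR0] at h3
      rw [div_le_iff₀ hR0] at h4
      have h5 : (x.2 : ℝ) < 1 := by
        have : 2 / (l : ℝ) * R = 2 * (R / l) := by ring
        linarith
      have h3' : 0 < x.2 := by exact_mod_cast h3
      have h5' : x.2 < 1 := by exact_mod_cast h5
      omega
    have hA := area_regionStar_le hl
    rw [h0, Nat.cast_zero, zero_sub, abs_neg, abs_of_nonneg (by positivity)]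
    have hx : 0 < R / l := by positivity
    calc R ^ 2 * volume.real (regionStar l) ≤ R ^ 2 * (4 / (l : ℝ) ^ 2) := by gcongr
      _ = 4 * (R / l) * (R / l) := by ring
      _ ≤ 4 * (R / l) * (1 / 2) := by gcongr
      _ ≤ 300 * (R / l) := by linarith
      _ = 300 / l * R := by ring

lemma idx_scaled_le {Q : ℕ} {x : ℤ × ℤ} (hx : x ∈ pairs Q) : idx (scaled Q x) ≤ 2 * Q := by
  have hmem := scaled_mem_triangle hx
  simp only [pairs, Finset.mem_filter, Finset.mem_product, Finset.mem_Icc] at hx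
  obtain ⟨⟨⟨h1, h2⟩, h3, h4⟩, -, -⟩ := hx
  have hQ : (0 : ℝ) < Q := by exact_mod_cast h1.trans h2
  have h := (le_idx_iff hmem _).1 le_rfl
  have hx1 := (mem_triangle.1 hmem).1.2
  have hy : 1 / (Q : ℝ) ≤ (scaled Q x).2 := by
    simp only [scaled]
    gcongr
    exact_mod_cast h3
  have : (idx (scaled Q x) : ℝ) * (1 / Q) ≤ 2 :=
    (mul_le_mul_of_nonneg_left hy (Nat.cast_nonneg _)).trans (by linarith)
  rw [mul_one_div, div_le_iff₀ hQ] at this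
  exact_mod_cast this

lemma cnt_idx (Q : ℕ) : cnt Q (fun z => (idx z : ℝ)) =
    ∑ l ∈ Finset.range (2 * Q), cnt Q ((regionStar (l + 1)).indicator 1) := by
  simp only [cnt]
  rw [Finset.sum_comm]
  refine Finset.sum_congr rfl fun x hx => ?_
  have hmem := scaled_mem_triangle hx
  have hle := idx_scaled_le hx
  classical
  have h : ∀ l, (regionStar (l + 1)).indicator (1 : ℝ × ℝ → ℝ) (scaled Q x) =
      if l < idx (scaled Q x) then 1 else 0 := by
    intro l
    rw [Set.indicator_apply, mem_regionStar]
    simp [hmem]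
  simp only [h]
  rw [← Finset.sum_filter, Finset.sum_const, nsmul_eq_mul, mul_one]
  have : (Finset.range (2 * Q)).filter (fun l => l < idx (scaled Q x)) =
      Finset.range (idx (scaled Q x)) := by
    ext l
    simp only [Finset.mem_filter, Finset.mem_range]
    omega
  rw [this, Finset.card_range]

lemma integral_idx_sub_le (n : ℕ) :
    |∑ l ∈ Finset.range n, volume.real (regionStar (l + 1)) - ∫ z, (idx z : ℝ) ∂triMeasure| ≤
      8 / ((n : ℝ) + 1) := by
  have hlim := (hasSum_area_regionStar.tendsto_sum_nat.const_sub
    (∑ l ∈ Finset.range n, volume.real (regionStar (l + 1)))).abs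
  refine le_of_tendsto hlim ?_
  filter_upwards [eventually_ge_atTop n] with m hm
  rw [abs_sub_comm, ← Finset.sum_Ico_eq_sub _ hm,
    abs_of_nonneg (Finset.sum_nonneg fun _ _ => measureReal_nonneg)]
  calc _ ≤ ∑ l ∈ Finset.Ico n m, 4 / ((l + 1 : ℕ) : ℝ) ^ 2 :=
        Finset.sum_le_sum fun l _ => area_regionStar_le (Nat.succ_pos l)
    _ = ∑ l ∈ Finset.Ioo n (m + 1), 4 / (l : ℝ) ^ 2 := by
        rw [Finset.sum_Ico_add' (fun l : ℕ => 4 / (l : ℝ) ^ 2) n m 1]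
        rfl
    _ = 4 * ∑ l ∈ Finset.Ioo n (m + 1), ((l : ℝ) ^ 2)⁻¹ := by
        rw [Finset.mul_sum]
        rfl
    _ ≤ 4 * (2 / ((n : ℝ) + 1)) := by
        gcongr
        exact sum_Ioo_inv_sq_le n (m + 1)
    _ = 8 / ((n : ℝ) + 1) := by ring

lemma equidistributes_idx : Equidistributes fun z => (idx z : ℝ) := by
  set M := ∫ z, (idx z : ℝ) ∂triMeasure with hM
  refine ⟨integrable_idx, 1800 + 2 * M + 8 * density, fun Q hQ => ?_⟩
  have hL := one_le_log hQ
  have hQ0 : (0 : ℝ) < Q := by exact_mod_cast (by omega : 0 < Q)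
  set L := Real.log Q with hLdef
  have hsum : ∑ l ∈ Finset.range (2 * Q), volume.real (regionStar (l + 1)) ≤ M :=
    sum_le_hasSum _ (fun _ _ => measureReal_nonneg) hasSum_area_regionStar
  have hM0 : 0 ≤ M := integral_nonneg fun _ => Nat.cast_nonneg _
  have hharm : ∑ l ∈ Finset.range (2 * Q), 300 / ((l + 1 : ℕ) : ℝ) ≤ 300 * (3 * L) := by
    have h := sum_Icc_inv_le (2 * Q)
    have e : ∑ l ∈ Finset.range (2 * Q), 300 / ((l + 1 : ℕ) : ℝ) =
        300 * ∑ d ∈ Finset.Icc 1 (2 * Q), (d : ℝ)⁻¹ := by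
      rw [Finset.mul_sum, Finset.range_eq_Ico,
        Finset.sum_Ico_add' (fun l : ℕ => 300 / (l : ℝ)) 0 (2 * Q) 1]
      rfl
    have h2 : Real.log ((2 * Q : ℕ) : ℝ) ≤ 1 + L := by
      push_cast
      rw [Real.log_mul (by norm_num) hQ0.ne']
      linarith [Real.log_two_lt_d9]
    rw [e]
    linarith
  have h1 : |cnt Q (fun z => (idx z : ℝ)) - density * Q ^ 2 *
      ∑ l ∈ Finset.range (2 * Q), volume.real (regionStar (l + 1))| ≤
        300 * (3 * L) * (Q * (1 + L)) + 2 * Q * M := by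
    rw [cnt_idx, Finset.mul_sum, ← Finset.sum_sub_distrib]
    refine (Finset.abs_sum_le_sum_abs _ _).trans ?_
    refine (Finset.sum_le_sum fun l _ => abs_cnt_indicator_sub_le
      (fun z hz => (mem_regionStar.1 hz).1)
      (fun R hR => abs_lattice_regionStar_sub_le (Nat.succ_pos l) hR) (by omega)).trans ?_
    rw [Finset.sum_add_distrib]
    refine add_le_add ?_ ?_
    · simp only [mul_assoc _ (Q : ℝ)]
      rw [← Finset.sum_mul]
      gcongr
    · rw [← Finset.mul_sum]
      gcongr
  have h2 : |density * Q ^ 2 * ∑ l ∈ Finset.range (2 * Q), volume.real (regionStar (l + 1)) -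
      density * Q ^ 2 * M| ≤ 8 * density * Q := by
    have hd := density_pos
    rw [← mul_sub, abs_mul, abs_of_nonneg (by positivity)]
    calc _ ≤ density * Q ^ 2 * (8 / (((2 * Q : ℕ) : ℝ) + 1)) := by
          gcongr
          exact integral_idx_sub_le (2 * Q)
      _ ≤ density * Q ^ 2 * (8 / Q) := by
          gcongr
          push_cast
          linarith
      _ = 8 * density * Q := by field_simp
  refine (abs_sub_le _ _ _).trans ((add_le_add h1 h2).trans ?_)
  have hd := density_pos
  have hLL : 1 ≤ L ^ 2 := by nlinarith
  have t1 : 300 * (3 * L) * (Q * (1 + L)) ≤ 300 * (3 * L) * (Q * (L + L)) := by gcongr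
  have t2 : 2 * (Q : ℝ) * M * 1 ≤ 2 * Q * M * L ^ 2 := by gcongr
  have t3 : 8 * density * Q * 1 ≤ 8 * density * Q * L ^ 2 := by gcongr
  nlinarith

/-! ### Products of indices along an orbit -/

open Classical in
/-- The Farey triangle is covered by finitely many polygonal sets, on each of which either the
first `n` indices are constant, or the index at one fixed time exceeds `C`. -/
lemma exists_polygonal_cover (C n : ℕ) : ∃ F : Finset (Set (ℝ × ℝ)),
    (∀ S ∈ F, ∃ k, Polygonal k S) ∧ (∀ z ∈ triangle, ∃ S ∈ F, z ∈ S) ∧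
    ∀ S ∈ F, (∃ a : ℕ → ℕ, ∀ z ∈ triangle, z ∈ S → ∀ j < n, idx (T^[j] z) = a j) ∨
      ∃ j < n, ∀ z ∈ triangle, z ∈ S → C < idx (T^[j] z) := by
  induction n with
  | zero =>
    refine ⟨{Set.univ}, ?_, ?_, ?_⟩
    · simpa using ⟨1, polygonal_univ⟩
    · simp
    · intro S _
      exact Or.inl ⟨fun _ => 0, fun _ _ _ j hj => absurd hj (Nat.not_lt_zero j)⟩
  | succ n ih =>
    obtain ⟨F, h1, h2, h3⟩ := ih
    refine ⟨insert (regionStar (C + 1)) ((Finset.range (C + 1) ×ˢ F).image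
      fun x => region x.1 ∩ branch x.1 ⁻¹' x.2), ?_, ?_, ?_⟩
    · intro S hS
      rcases Finset.mem_insert.1 hS with rfl | hS
      · exact ⟨6, polygonal_regionStar _⟩
      · obtain ⟨⟨l, S⟩, hx, rfl⟩ := Finset.mem_image.1 hS
        obtain ⟨k, hk⟩ := h1 S (Finset.mem_product.1 hx).2
        exact ⟨12 + k, (polygonal_region l).inter (hk.preimage_branch l)⟩
    · intro z hz
      by_cases hC : C + 1 ≤ idx z
      · exact ⟨_, Finset.mem_insert_self _ _, mem_regionStar.2 ⟨hz, hC⟩⟩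
      · obtain ⟨S, hS, hTS⟩ := h2 _ (T_mem hz)
        refine ⟨region (idx z) ∩ branch (idx z) ⁻¹' S, Finset.mem_insert_of_mem
          (Finset.mem_image.2 ⟨(idx z, S), Finset.mem_product.2
            ⟨Finset.mem_range.2 (by simp only; omega), hS⟩, rfl⟩), ?_, ?_⟩
        · rw [region_eq]
          exact ⟨hz, rfl⟩
        · rw [Set.mem_preimage, ← T_eq_branch hz]
          exact hTS
    · intro S hS
      rcases Finset.mem_insert.1 hS with rfl | hS
      · exact Or.inr ⟨0, Nat.succ_pos n, fun z _ hz => (mem_regionStar.1 hz).2⟩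
      · obtain ⟨⟨l, S⟩, hx, rfl⟩ := Finset.mem_image.1 hS
        have hT : ∀ z ∈ triangle, z ∈ region l ∩ branch l ⁻¹' S → idx z = l ∧ T z ∈ S := by
          intro z hz hzS
          rw [region_eq] at hzS
          obtain ⟨⟨-, hl⟩, hzS⟩ := hzS
          exact ⟨hl, by rw [T_eq_branch hz, hl]; exact hzS⟩
        rcases h3 S (Finset.mem_product.1 hx).2 with ⟨a, ha⟩ | ⟨j, hj, hja⟩
        · refine Or.inl ⟨fun j => if j = 0 then l else a (j - 1), fun z hz hzS j hj => ?_⟩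
          obtain ⟨hl, hTS⟩ := hT z hz hzS
          rcases j with _ | j
          · exact hl
          · exact ha _ (T_mem hz) hTS j (by omega)
        · refine Or.inr ⟨j + 1, by omega, fun z hz hzS => ?_⟩
          exact hja _ (T_mem hz) (hT z hz hzS).2

open Classical in
/-- A function that is constant on each member of a finite polygonal cover of the Farey triangle
is equidistributed. -/
lemma equidistributes_of_cover {f : ℝ × ℝ → ℝ} (F : Finset (Set (ℝ × ℝ)))
    (hF : ∀ S ∈ F, ∃ k, Polygonal k S) (hcov : ∀ z ∈ triangle, ∃ S ∈ F, z ∈ S)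
    (hf : ∀ S ∈ F, ∃ c, ∀ z ∈ triangle, z ∈ S → f z = c) : Equidistributes f := by
  choose! c hc using hf
  set level : ℝ → Set (ℝ × ℝ) := fun v => triangle ∩ ⋃ S ∈ F.filter (fun S => c S = v), S
    with hlevel
  have hmem : ∀ v, ∀ z ∈ triangle, z ∈ level v ↔ f z = v := by
    intro v z hz
    simp only [hlevel, Set.mem_inter_iff, hz, true_and, Set.mem_iUnion, Finset.mem_filter,
      exists_prop]
    constructor
    · rintro ⟨S, ⟨hS, rfl⟩, hzS⟩
      exact hc S hS z hz hzS
    · rintro rfl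
      obtain ⟨S, hS, hzS⟩ := hcov z hz
      exact ⟨S, ⟨hS, (hc S hS z hz hzS).symm⟩, hzS⟩
  have h : Equidistributes fun z => ∑ v ∈ F.image c, v * (level v).indicator 1 z := by
    refine equidistributes_sum _ _ fun v _ => Equidistributes.const_mul ?_ v
    obtain ⟨k, hk⟩ := polygonal_biUnion (F.filter fun S => c S = v) id
      fun S hS => hF S (Finset.mem_filter.1 hS).1
    exact equidistributes_indicator (polygonal_triangle.inter hk) Set.inter_subset_left
  refine h.congr fun z hz => ?_
  obtain ⟨S, hS, hzS⟩ := hcov z hz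
  rw [Finset.sum_eq_single (f z)]
  · rw [Set.indicator_of_mem ((hmem _ z hz).2 rfl), Pi.one_apply, mul_one]
  · intro v _ hv
    rw [Set.indicator_of_notMem fun hm => hv ((hmem v z hz).1 hm).symm, mul_zero]
  · intro hv
    exact absurd (Finset.mem_image.2 ⟨S, hS, (hc S hS z hz hzS).symm⟩) hv

/-- A large index at one time determines the indices at all nearby times. -/
lemma idx_near_large {z : ℝ × ℝ} (hz : z ∈ triangle) {n i j : ℕ} (hi : i ∈ Finset.Icc 1 n)
    (hj : j ∈ Finset.Icc 1 n) (hij : i ≠ j) (hn : 4 * n + 6 < idx (T^[j - 1] z)) :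
    idx (T^[i - 1] z) = tailIdx ((i - j) + (j - i)) := by
  rw [Finset.mem_Icc] at hi hj
  rcases lt_or_gt_of_ne hij with h | h
  · rw [idx_before_large hz (show i - 1 < j - 1 by omega) (by omega) hn]
    congr 1
    omega
  · rw [idx_after_large hz (show j - 1 < i - 1 by omega) (show i - 1 ≤ n by omega) hn]
    congr 1
    omega

/-- Where the index at time `j` is large, the other factors of `idxProd J` are constant. Hence
`idxProd J` minus a linear combination of single indices is constant on each member of a finite
polygonal cover. -/
lemma equidistributes_idxProd {n : ℕ} {J : Finset ℕ} (hJ : J ⊆ Finset.Icc 1 n) :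
    Equidistributes (idxProd J) := by
  set t : ℕ → ℕ → ℝ := fun j i => (tailIdx ((i - j) + (j - i)) : ℝ) with ht
  set c : ℕ → ℝ := fun j => ∏ i ∈ J.erase j, t j i with hc
  obtain ⟨F, h1, h2, h3⟩ := exists_polygonal_cover (4 * n + 6) n
  have hbounded : Equidistributes
      fun z => idxProd J z - ∑ j ∈ J, c j * (idx (T^[j - 1] z) : ℝ) := by
    refine equidistributes_of_cover F h1 h2 fun S hS => ?_
    rcases h3 S hS with ⟨a, ha⟩ | ⟨j, hj, hja⟩
    · refine ⟨∏ j ∈ J, (a (j - 1) : ℝ) - ∑ j ∈ J, c j * (a (j - 1) : ℝ), fun z hz hzS => ?_⟩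
      have hlt : ∀ j ∈ J, j - 1 < n := fun j hj => by
        have := Finset.mem_Icc.1 (hJ hj)
        omega
      rw [idxProd, Finset.prod_congr rfl fun j hj => by rw [ha z hz hzS _ (hlt j hj)],
        Finset.sum_congr rfl fun j hj => by rw [ha z hz hzS _ (hlt j hj)]]
    · have hj' : j + 1 ∈ Finset.Icc 1 n := Finset.mem_Icc.2 ⟨by omega, by omega⟩
      have hval : ∀ z ∈ triangle, z ∈ S → ∀ i ∈ J.erase (j + 1),
          (idx (T^[i - 1] z) : ℝ) = t (j + 1) i := by
        intro z hz hzS i hi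
        rw [Finset.mem_erase] at hi
        rw [idx_near_large hz (hJ hi.2) hj' hi.1 (hja z hz hzS)]
      refine ⟨(if j + 1 ∈ J then 0 else c (j + 1)) -
        ∑ i ∈ J.erase (j + 1), c i * t (j + 1) i, fun z hz hzS => ?_⟩
      have hp : ∏ i ∈ J.erase (j + 1), (idx (T^[i - 1] z) : ℝ) = c (j + 1) :=
        Finset.prod_congr rfl (hval z hz hzS)
      have hs : ∑ i ∈ J.erase (j + 1), c i * (idx (T^[i - 1] z) : ℝ) =
          ∑ i ∈ J.erase (j + 1), c i * t (j + 1) i :=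
        Finset.sum_congr rfl fun i hi => by rw [hval z hz hzS i hi]
      by_cases hmem : j + 1 ∈ J
      · -- the unbounded factor cancels against its own term in the sum
        rw [idxProd, if_pos hmem, ← Finset.mul_prod_erase J _ hmem,
          ← Finset.add_sum_erase J _ hmem, hp, hs]
        ring
      · rw [Finset.erase_eq_of_notMem hmem] at hp hs ⊢
        rw [idxProd, if_neg hmem, hp, hs]
  have h := hbounded.add (equidistributes_sum J (fun j z => c j * (idx (T^[j - 1] z) : ℝ))
    fun j _ => (equidistributes_idx.comp_iterate_T (j - 1)).const_mul (c j))
  exact h.congr fun z _ => sub_add_cancel _ _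

/-! ### The averages -/

lemma area_triangle : volume.real triangle = 1 / 2 := by
  have hslice : ∀ x : ℝ, volume (Prod.mk x ⁻¹' triangle) =
      (Set.Icc (0 : ℝ) 1).indicator (fun x => ENNReal.ofReal x) x := by
    intro x
    by_cases hx : x ∈ Set.Icc (0 : ℝ) 1
    · have : Prod.mk x ⁻¹' triangle = Set.Ioc (1 - x) 1 := by
        ext y
        rw [Set.mem_preimage]
        simp only [triangle, Set.mem_ofPred_eq, Set.mem_Icc, Set.mem_Ioc]
        rw [Set.mem_Icc] at hx
        constructor
        · rintro ⟨-, h1, h2⟩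
          exact ⟨by linarith, h1.2⟩
        · rintro ⟨h1, h2⟩
          exact ⟨hx, ⟨by linarith [hx.2], h2⟩, by linarith⟩
      rw [this, Real.volume_Ioc, Set.indicator_of_mem hx, sub_sub_cancel]
    · have : Prod.mk x ⁻¹' triangle = ∅ :=
        Set.eq_empty_iff_forall_notMem.2 fun y hy => hx hy.1
      rw [this, Set.indicator_of_notMem hx, measure_empty]
  have h : volume triangle = ENNReal.ofReal (1 / 2) := by
    rw [Measure.volume_eq_prod, Measure.prod_apply measurableSet_triangle]
    simp_rw [hslice]
    rw [lintegral_indicator measurableSet_Icc, ← ofReal_integral_eq_lintegral_ofReal]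
    · rw [integral_Icc_eq_integral_Ioc, ← intervalIntegral.integral_of_le zero_le_one,
        integral_id]
      norm_num
    · exact continuous_id.continuousOn.integrableOn_Icc
    · exact (ae_restrict_mem measurableSet_Icc).mono fun x hx => hx.1
  rw [Measure.real, h, ENNReal.toReal_ofReal (by norm_num)]

lemma equidistributes_one : Equidistributes 1 :=
  (equidistributes_indicator polygonal_triangle le_rfl).congr
    fun _ hz => Set.indicator_of_mem hz _

/-- Averages of equidistributed functions over consecutive Farey fractions. -/
lemma Equidistributes.average_isBigO {f : ℝ × ℝ → ℝ} (hf : Equidistributes f) :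
    (fun Q : ℕ => 1 / (N Q : ℝ) * cnt Q f - 2 * ∫ z, f z ∂triMeasure) =O[atTop]
      fun Q : ℕ => Real.log (Q : ℝ) ^ 2 / (Q : ℝ) := by
  obtain ⟨-, C, hC⟩ := hf
  obtain ⟨-, D, hD⟩ := equidistributes_one
  have hone : ∫ z, (1 : ℝ × ℝ → ℝ) z ∂triMeasure = 1 / 2 := by
    rw [← area_triangle]
    simp [triMeasure, Measure.real]
  set I := ∫ z, f z ∂triMeasure with hI
  have hd := density_pos
  have hsmall : ∀ᶠ Q : ℕ in atTop, D * Real.log Q ^ 2 ≤ density / 4 * Q := by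
    have h := (Real.isLittleO_pow_log_id_atTop (n := 2)).const_mul_left D
    have h' := (h.comp_tendsto tendsto_natCast_atTop_atTop).bound
      (show 0 < density / 4 by positivity)
    filter_upwards [h'] with Q hQ
    simp only [Function.comp_apply, id_eq, Real.norm_eq_abs, Nat.abs_cast] at hQ
    exact (le_abs_self _).trans hQ
  refine IsBigO.of_bound ((C + |2 * I| * D) / (density / 4)) ?_
  filter_upwards [hsmall, eventually_ge_atTop 3] with Q hQ hQ3
  have hQ0 : (0 : ℝ) < Q := by exact_mod_cast (by omega : 0 < Q)
  have h1 := hC Q hQ3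
  have h2 := hD Q hQ3
  rw [hone, cnt_one (by omega)] at h2
  set W := (Q : ℝ) * Real.log Q ^ 2 with hW
  have hN : density / 4 * Q ^ 2 ≤ N Q := by
    have := (abs_le.1 h2).1
    have : D * W ≤ density / 4 * Q ^ 2 := by
      calc D * W = D * Real.log Q ^ 2 * Q := by rw [hW]; ring
        _ ≤ density / 4 * Q * Q := by gcongr
        _ = density / 4 * Q ^ 2 := by ring
    linarith
  have hN0 : (0 : ℝ) < N Q := lt_of_lt_of_le (by positivity) hN
  have hnum : |cnt Q f - 2 * I * N Q| ≤ (C + |2 * I| * D) * W := by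
    have e : cnt Q f - 2 * I * N Q = (cnt Q f - density * Q ^ 2 * I) -
        2 * I * (N Q - density * Q ^ 2 * (1 / 2)) := by ring
    rw [e]
    refine (abs_sub _ _).trans ?_
    rw [abs_mul, add_mul, mul_assoc |2 * I|]
    exact add_le_add h1 (mul_le_mul_of_nonneg_left h2 (abs_nonneg _))
  have e : 1 / (N Q : ℝ) * cnt Q f - 2 * I = (cnt Q f - 2 * I * N Q) / N Q := by
    field_simp
  rw [Real.norm_eq_abs, e, abs_div, abs_of_pos hN0, Real.norm_eq_abs,
    abs_of_nonneg (by positivity : 0 ≤ Real.log Q ^ 2 / (Q : ℝ))]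
  calc _ ≤ (C + |2 * I| * D) * W / N Q := by gcongr
    _ ≤ (C + |2 * I| * D) * W / (density / 4 * Q ^ 2) := by
        gcongr
        exact (abs_nonneg _).trans hnum
    _ = _ := by rw [hW]; field_simp

lemma average_eq {Q : ℕ} (hQ : 1 ≤ Q) (n : ℕ) :
    average Q (n + 1) = 1 / (N Q : ℝ) * cnt Q fun z =>
      ∑ m ∈ (K n).support, (sign (n + 1) m.support : ℝ) * idxProd m.support z := by
  rw [average, ← sum_point hQ]
  simp only [nu_eq_sum hQ]

end FareyIndex

end

theorem theorem2 :
    ∃ B : ℕ → ℝ,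
      (∀ k : ℕ, (fun Q : ℕ => FareyIndex.average Q k - B k)
        =O[atTop] (fun Q : ℕ => (Real.log (Q : ℝ)) ^ 2 / (Q : ℝ))) ∧
      B 0 = 0 ∧
      ∀ k : ℕ, 1 ≤ k →
        (∀ m ∈ (FareyIndex.K (k - 1)).support,
          Summable (fun l : m.support → ℕ+ => FareyIndex.interArea m.support l)) ∧
        B k = 2 * ∑ m ∈ (FareyIndex.K (k - 1)).support,
          (FareyIndex.sign k m.support : ℝ) *
            ∑' l : m.support → ℕ+, FareyIndex.interArea m.support l := by
  have hprod : ∀ n, ∀ m ∈ (FareyIndex.K n).support,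
      FareyIndex.Equidistributes (FareyIndex.idxProd m.support) := fun n m hm =>
    FareyIndex.equidistributes_idxProd (n := n) fun j hj =>
      Finset.mem_Icc.2 ((FareyIndex.K_support n m hm).2.2 j hj)
  refine ⟨fun k => if k = 0 then 0 else 2 * ∑ m ∈ (FareyIndex.K (k - 1)).support,
    (FareyIndex.sign k m.support : ℝ) *
      ∑' l : m.support → ℕ+, FareyIndex.interArea m.support l, ?_, if_pos rfl, ?_⟩
  · rintro (_ | n)
    · have : (fun Q : ℕ => FareyIndex.average Q 0 - 0) = fun _ => (0 : ℝ) := by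
        funext Q
        simp [FareyIndex.average, FareyIndex.nu_zero]
      simp only [if_true, this]
      exact isBigO_zero _ _
    · have hF := FareyIndex.equidistributes_sum (FareyIndex.K n).support
        (fun m z => (FareyIndex.sign (n + 1) m.support : ℝ) * FareyIndex.idxProd m.support z)
        fun m hm => (hprod n m hm).const_mul _
      refine hF.average_isBigO.congr' ?_ (EventuallyEq.refl _ _)
      filter_upwards [eventually_ge_atTop 1] with Q hQ
      rw [FareyIndex.average_eq hQ, if_neg (Nat.succ_ne_zero n), Nat.add_sub_cancel,
        integral_finsetSum _ fun m hm => (hprod n m hm).1.const_mul _]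
      congr 2
      refine Finset.sum_congr rfl fun m hm => ?_
      rw [integral_const_mul, (FareyIndex.hasSum_interArea (hprod n m hm).1).tsum_eq]
  · intro k hk
    refine ⟨fun m hm => (FareyIndex.hasSum_interArea (hprod _ m hm).1).summable, ?_⟩
    exact if_neg (by omega)
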